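/- \textbf{Setting.} Let $f^{\{1\}},\dots,f^{\{N\}}:\mathbb R^d\to\mathbb R^d$ be $C^\infty$ vector fields. For $v\subseteq\{1,\dots,N\}$ put $f^{\{v\}}=\sum_{m\in v}f^{\{m\}}$, let $\mathcal L^{\{v\}}=\langle f^{\{v\}},\nabla\rangle$ be its Lie derivative and $\varphi^{\{v\}}_t$ its (local) exact flow; write $f$ and $\mathcal L$ for $v=\{1,\dots,N\}$. A \emph{splitting tree} is a full ordered binary tree whose nodes are non-empty subsets of $\{1,\dots,N\}$, whose root is $r=\{1,\dots,N\}$, in which every inner node is the disjoint union of its left and right child, and whose leaves are singletons. Let $I$ be the set of inner nodes, $L$ the set of leaves, $\mathcal P^{\{v\}}$ the set of inner nodes on the path from $r$ to $v$, excluding $v$. For $w\in\mathcal P^{\{v\}}$ let $\delta^{\{v\}}(w)=1$ if this path continues to the left child of $w$ and $\delta^{\{v\}}(w)=0$ if it continues to the right child. A \emph{hierarchical splitting method} consists of a splitting tree; for each inner node $i$, real coefficients $a^{\{i\}}_1,b^{\{i\}}_1,\dots,a^{\{i\}}_{s^{\{i\}}},b^{\{i\}}_{s^{\{i\}}}$;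 a set $L'\subseteq L$; and for each $\ell\in L'$ a one-step scheme $\Phi^{\{\ell\}}_h$. The method assigned to an inner node $i$ with left child $v$ and right child $w$ is $$\Phi^{\{i\}}_h=\varphi^{\{w\}}_{b^{\{i\}}_{s^{\{i\}}}h}\circ\varphi^{\{v\}}_{a^{\{i\}}_{s^{\{i\}}}h}\circ\dots\circ\varphi^{\{w\}}_{b^{\{i\}}_1h}\circ\varphi^{\{v\}}_{a^{\{i\}}_1h}.$$ The hierarchical method is $\Phi_h=\widehat\Phi^{\{r\}}_h$, where $\widehat\Phi^{\{\ell\}}_h=\Phi^{\{\ell\}}_h$ for $\ell\in L'$, $\widehat\Phi^{\{\ell\}}_h=\varphi^{\{\ell\}}_h$ for $\ell\in L\setminus L'$, and, for an inner node $i$ with children $v,w$ as above, $\widehat\Phi^{\{i\}}_h$ is defined recursively by the displayed formula with the exact flows $\varphi^{\{v\}},\varphi^{\{w\}}$ replaced by $\widehat\Phi^{\{v\}},\widehat\Phi^{\{w\}}$. For a one-step map $\Psi_h$, a $C^\infty$ vector field $g$, an integer $q\ge 1$ and an operator $\mathcal O$ that is the Lie derivative along a $C^\infty$ vector field, the formal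 identity $$\Psi_h=\exp\!\big(h\langle g,\nabla\rangle+h^{q+1}\mathcal O+O(h^{q+2})\big)\mathrm{Id}$$ means: for some choice of the term $O(h^{q+2})$ as a formal power series in $h$, starting at $h^{q+2}$, whose coefficients are Lie derivatives along $C^\infty$ vector fields, the formal power series in $h$ obtained by applying the exponential series to $\mathrm{Id}$ and evaluating at $x$ is the asymptotic expansion of $\Psi_h(x)$ as $h\to0$, to all orders and locally uniformly in $x$. \textbf{Theorem.} Suppose that every $v\in I\cup L'$ has an integer order $p^{\{v\}}\ge 1$ and an operator $\mathcal O^{\{v\}}_{p^{\{v\}}+1}$ (the Lie derivative along a $C^\infty$ vector field) with $$\Phi^{\{v\}}_h=\exp\!\big(h\mathcal L^{\{v\}}+h^{p^{\{v\}}+1}\mathcal O^{\{v\}}_{p^{\{v\}}+1}+O(h^{p^{\{v\}}+2})\big)\mathrm{Id}.$$ Suppose $I\cup L'\neq\emptyset$ and let $p=\min_{v\in I\cup L'}p^{\{v\}}$. Then $$\Phi_h=\exp\!\big(h\mathcal L+h^{p+1}\mathcal O_{p+1}+O(h^{p+2})\big)\mathrm{Id},$$ $$\mathcal O_{p+1}=\sum_{\substack{v\in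 I\cup L'\\ p^{\{v\}}=p}}\Bigg[\prod_{w\in\mathcal P^{\{v\}}}\sum_{j=1}^{s^{\{w\}}}\Big(\delta^{\{v\}}(w)\,a^{\{w\}}_j+(1-\delta^{\{v\}}(w))\,b^{\{w\}}_j\Big)^{p+1}\Bigg]\mathcal O^{\{v\}}_{p+1},$$ and $\Phi_h$ is at least convergent of order $p$: for every solution $x$ of $x'=f(x)$ on an interval $[0,T]$ there are $C$ and $h_0>0$ such that $\|(\Phi_h)^{n}(x(0))-x(nh)\|\le C\,h^p$ for all $0<h\le h_0$ and all integers $n\ge0$ with $nh\le T$, where $(\Phi_h)^n$ is the $n$-fold composition. -/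

import Mathlib

open Filter Topology Asymptotics
open scoped ContDiff Nat

noncomputable section

/-! ### Smooth maps, Lie derivatives, formal exponentials -/

/-- The real vector space of `C^∞` maps from `ℝ^d` to `ℝ^d`. Its elements serve both as vector
fields and as the (vector-valued) functions on which differential operators act. -/
def SmoothMap (d : ℕ) : Submodule ℝ (EuclideanSpace ℝ (Fin d) → EuclideanSpace ℝ (Fin d)) where
  carrier := {g | ContDiff ℝ ∞ g}
  add_mem' := by
    intro u v hu hv
    rw [Set.mem_ofPred_eq] at *
    exact hu.add hv
  zero_mem' := by
    rw [Set.mem_ofPred_eq]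
    exact contDiff_const
  smul_mem' := by
    intro c u hu
    rw [Set.mem_ofPred_eq] at *
    exact hu.const_smul c

namespace SmoothMap

theorem contDiff_coe {d : ℕ} (u : SmoothMap d) : ContDiff ℝ ∞ u.1 := u.2

theorem differentiableAt_coe {d : ℕ} (u : SmoothMap d) (x : EuclideanSpace ℝ (Fin d)) :
    DifferentiableAt ℝ u.1 x :=
  (contDiff_coe u).differentiable (by simp) x

/-- The identity map of `ℝ^d`. -/
def identity (d : ℕ) : SmoothMap d :=
  ⟨id, (contDiff_id : ContDiff ℝ ∞ (id : EuclideanSpace ℝ (Fin d) → EuclideanSpace ℝ (Fin d)))⟩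

theorem contDiff_lieDeriv {d : ℕ} (g u : SmoothMap d) :
    ContDiff ℝ ∞ fun x => fderiv ℝ u.1 x (g.1 x) :=
  ((contDiff_coe u).fderiv_right (m := ∞) (by simp)).clm_apply (contDiff_coe g)

/-- The Lie derivative `⟨g, ∇⟩` along the vector field `g`: it sends a smooth map `u` to
`x ↦ Du(x) g(x) = ∑ i, g_i(x) ∂_i u(x)`. -/
def lieDeriv {d : ℕ} (g : SmoothMap d) : Module.End ℝ (SmoothMap d) where
  toFun u := ⟨fun x => fderiv ℝ u.1 x (g.1 x), contDiff_lieDeriv g u⟩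
  map_add' u v := by
    apply Subtype.ext
    funext x
    change fderiv ℝ (u.1 + v.1) x (g.1 x) = fderiv ℝ u.1 x (g.1 x) + fderiv ℝ v.1 x (g.1 x)
    rw [fderiv_add (differentiableAt_coe u x) (differentiableAt_coe v x)]
    rfl
  map_smul' c u := by
    apply Subtype.ext
    funext x
    change fderiv ℝ (c • u.1) x (g.1 x) = c • fderiv ℝ u.1 x (g.1 x)
    rw [fderiv_const_smul (differentiableAt_coe u x)]
    rfl

end SmoothMap

/-- The exponential `∑ k, X^k / k!` of a formal power series `X` in the step size `h`, with
operator coefficients and zero constant term. Since `X^k` is divisible by `h^k`, only `k ≤ n`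
contributes to the coefficient of `h^n`. -/
def formalExp {d : ℕ} (X : PowerSeries (Module.End ℝ (SmoothMap d))) :
    PowerSeries (Module.End ℝ (SmoothMap d)) :=
  PowerSeries.mk fun n =>
    ∑ k ∈ Finset.range (n + 1), ((k ! : ℝ)⁻¹) • PowerSeries.coeff n (X ^ k)

/-- `Φ_h = S(h) Id` as formal power series in `h`: the series `∑ k, h^k (S_k Id)(x)` is the
asymptotic expansion of `Φ_h(x)` as `h → 0`, to every order and locally uniformly in `x`. -/
def RepresentedBy {d : ℕ} (Φ : ℝ → EuclideanSpace ℝ (Fin d) → EuclideanSpace ℝ (Fin d))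
    (S : PowerSeries (Module.End ℝ (SmoothMap d))) : Prop :=
  ∀ (n : ℕ) (x₀ : EuclideanSpace ℝ (Fin d)),
    (fun z : ℝ × EuclideanSpace ℝ (Fin d) =>
      Φ z.1 z.2 - ∑ k ∈ Finset.range n,
        z.1 ^ k • (PowerSeries.coeff k S (SmoothMap.identity d)).1 z.2)
      =O[𝓝 ((0 : ℝ), x₀)] (fun z => z.1 ^ n)

/-- `Φ_h = exp(h L_g + h^(p+1) L_e + O(h^(p+2))) Id`, where `L_g` and `L_e` are the Lie derivatives
along `g` and `e`, and the term `O(h^(p+2))` in the exponent is `h^(p+2)` times a formal power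
series in `h` whose coefficients are Lie derivatives along smooth vector fields. -/
def HasExpExpansion {d : ℕ} (Φ : ℝ → EuclideanSpace ℝ (Fin d) → EuclideanSpace ℝ (Fin d))
    (g : SmoothMap d) (p : ℕ) (e : SmoothMap d) : Prop :=
  ∃ r : ℕ → SmoothMap d,
    RepresentedBy Φ (formalExp
      (PowerSeries.monomial 1 (SmoothMap.lieDeriv g)
        + PowerSeries.monomial (p + 1) (SmoothMap.lieDeriv e)
        + PowerSeries.X ^ (p + 2) * PowerSeries.mk fun k => SmoothMap.lieDeriv (r k)))

/-! ### Flows and convergence -/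

open Classical in
/-- The exact flow of `x' = g(x)`: the value at time `t` of the solution starting at `x` at time
`0`, if that solution exists on the closed interval between `0` and `t` (and `x` otherwise). -/
def exactFlow {d : ℕ} (g : SmoothMap d) (t : ℝ) (x : EuclideanSpace ℝ (Fin d)) :
    EuclideanSpace ℝ (Fin d) :=
  if H : ∃ γ : ℝ → EuclideanSpace ℝ (Fin d), γ 0 = x ∧
      IsIntegralCurveOn γ (fun _ => g.1) (Set.uIcc 0 t)
  then H.choose t else x

/-- The one-step method `Φ` converges with order `p` for `x' = g(x)`: along every solution on a
compact time interval `[0, T]`, the global error is `O(h^p)`, uniformly over the grid. -/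
def ConvergesWithOrder {d : ℕ} (Φ : ℝ → EuclideanSpace ℝ (Fin d) → EuclideanSpace ℝ (Fin d))
    (g : SmoothMap d) (p : ℕ) : Prop :=
  ∀ (T : ℝ) (x : ℝ → EuclideanSpace ℝ (Fin d)),
    IsIntegralCurveOn x (fun _ => g.1) (Set.Icc 0 T) →
    ∃ C h₀ : ℝ, 0 < h₀ ∧ ∀ h : ℝ, 0 < h → h ≤ h₀ → ∀ n : ℕ, (n : ℝ) * h ≤ T →
      ‖(Φ h)^[n] (x 0) - x (n * h)‖ ≤ C * h ^ p

/-! ### Splitting trees -/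

/-- Full ordered binary trees whose leaves carry an element of `{1, …, N}`. -/
inductive LeafTree (N : ℕ) : Type
  | leaf (m : Fin N) : LeafTree N
  | node (l r : LeafTree N) : LeafTree N

namespace LeafTree

variable {N : ℕ}

/-- The subset of `{1, …, N}` attached to the root: a leaf carries a singleton, an inner node the
union of its children. -/
def label : LeafTree N → Finset (Fin N)
  | leaf m => {m}
  | node l r => l.label ∪ r.label

/-- At every inner node the two children are disjoint. -/
def DisjointChildren : LeafTree N → Prop
  | leaf _ => True
  | node l r => Disjoint l.label r.label ∧ l.DisjointChildren ∧ r.DisjointChildren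

/-- A splitting tree for `N` partitions: the root is `{1, …, N}`, every inner node is the disjoint
union of its two children, every leaf is a singleton. -/
def IsSplittingTree (t : LeafTree N) : Prop :=
  t.label = Finset.univ ∧ t.DisjointChildren

/-- The set of inner nodes, a node being identified with its subset of `{1, …, N}`. -/
def innerNodes : LeafTree N → Finset (Finset (Fin N))
  | leaf _ => ∅
  | node l r => insert (l.label ∪ r.label) (l.innerNodes ∪ r.innerNodes)

/-- The set of leaf nodes. -/
def leafNodes : LeafTree N → Finset (Finset (Fin N))
  | leaf m => {{m}}
  | node l r => l.leafNodes ∪ r.leafNodes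

/-- The left child of an inner node `w`. -/
def leftChild : LeafTree N → Finset (Fin N) → Finset (Fin N)
  | leaf _, _ => ∅
  | node l r, w =>
      if w = l.label ∪ r.label then l.label
      else if w ∈ l.innerNodes then l.leftChild w else r.leftChild w

/-- The right child of an inner node `w`. -/
def rightChild : LeafTree N → Finset (Fin N) → Finset (Fin N)
  | leaf _, _ => ∅
  | node l r, w =>
      if w = l.label ∪ r.label then r.label
      else if w ∈ l.innerNodes then l.rightChild w else r.rightChild w

/-- The inner nodes on the path from the root to the node `v`, without `v` itself. -/
def path : LeafTree N → Finset (Fin N) → Finset (Finset (Fin N))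
  | leaf _, _ => ∅
  | node l r, v =>
      if v = l.label ∪ r.label then ∅
      else insert (l.label ∪ r.label)
        (if v ∈ l.innerNodes ∪ l.leafNodes then l.path v else r.path v)

/-- For `w` on the path from the root to `v`: `1` if the path continues to the left child of `w`,
`0` if it continues to the right child. -/
def branch (t : LeafTree N) (v w : Finset (Fin N)) : ℝ :=
  if t.leftChild w ∈ insert v (t.path v) then 1 else 0

end LeafTree

/-! ### Hierarchical splitting methods -/

/-- The map `Ψ_{b_s h} ∘ Φ_{a_s h} ∘ ⋯ ∘ Ψ_{b_1 h} ∘ Φ_{a_1 h}`. -/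
def twoSplit {d s : ℕ} (a b : Fin s → ℝ)
    (Φ Ψ : ℝ → EuclideanSpace ℝ (Fin d) → EuclideanSpace ℝ (Fin d))
    (h : ℝ) (x : EuclideanSpace ℝ (Fin d)) : EuclideanSpace ℝ (Fin d) :=
  Fin.foldl s (fun y j => Ψ (b j * h) (Φ (a j * h) y)) x

/-- The data of a hierarchical splitting method for `N` partitions: a splitting tree, for each inner
node `v` the coefficients of a splitting method with `stages v` stages, a set of leaves whose
subsystems are integrated numerically, and a scheme for each of them. Nodes are subsets of
`{1, …, N}`; values at other subsets are never used. -/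
structure HierarchicalSplitting (N d : ℕ) where
  tree : LeafTree N
  isSplittingTree : tree.IsSplittingTree
  stages : Finset (Fin N) → ℕ
  a : (v : Finset (Fin N)) → Fin (stages v) → ℝ
  b : (v : Finset (Fin N)) → Fin (stages v) → ℝ
  numericalLeaves : Finset (Finset (Fin N))
  numericalLeaves_subset : numericalLeaves ⊆ tree.leafNodes
  scheme : Finset (Fin N) → ℝ → EuclideanSpace ℝ (Fin d) → EuclideanSpace ℝ (Fin d)

namespace HierarchicalSplitting

variable {N d : ℕ}

/-- The nodes to which an approximate method is assigned: inner nodes and numerical leaves. -/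
def methodNodes (H : HierarchicalSplitting N d) : Finset (Finset (Fin N)) :=
  H.tree.innerNodes ∪ H.numericalLeaves

/-- The method assigned to the node `v`: at an inner node, the splitting method for two partitions
composed of the exact flows of the children's vector fields; at a numerical leaf, its scheme. -/
def nodeMethod (H : HierarchicalSplitting N d) (f : Fin N → SmoothMap d) (v : Finset (Fin N)) :
    ℝ → EuclideanSpace ℝ (Fin d) → EuclideanSpace ℝ (Fin d) :=
  if v ∈ H.tree.innerNodes then
    twoSplit (H.a v) (H.b v)
      (exactFlow (∑ m ∈ H.tree.leftChild v, f m)) (exactFlow (∑ m ∈ H.tree.rightChild v, f m))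
  else H.scheme v

/-- The recursive step on a subtree: an inner node runs the recursive steps of its children with
the step sizes `a_j h` and `b_j h`; a leaf applies its scheme or its exact flow. -/
def step (H : HierarchicalSplitting N d) (f : Fin N → SmoothMap d) :
    LeafTree N → ℝ → EuclideanSpace ℝ (Fin d) → EuclideanSpace ℝ (Fin d)
  | .leaf m => if {m} ∈ H.numericalLeaves then H.scheme {m} else exactFlow (f m)
  | .node l r =>
      twoSplit (H.a (l.label ∪ r.label)) (H.b (l.label ∪ r.label)) (H.step f l) (H.step f r)

/-- The hierarchical splitting method `Φ_h` itself. -/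
def method (H : HierarchicalSplitting N d) (f : Fin N → SmoothMap d) :
    ℝ → EuclideanSpace ℝ (Fin d) → EuclideanSpace ℝ (Fin d) :=
  H.step f H.tree

/-- The factor multiplying the error term of the node `v` in the leading error term of order
`p + 1`: the product along the path to `v` of `∑ j, (a_j or b_j)^(p+1)`. -/
def errorWeight (H : HierarchicalSplitting N d) (p : ℕ) (v : Finset (Fin N)) : ℝ :=
  ∏ w ∈ H.tree.path v, ∑ j : Fin (H.stages w),
    (H.tree.branch v w * H.a w j + (1 - H.tree.branch v w) * H.b w j) ^ (p + 1)

end HierarchicalSplitting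

end

/-! ### Powers of formal power series over a noncommutative semiring -/

namespace PowerSeries

variable {R : Type*} [Semiring R]

/-! No Baker–Campbell–Hausdorff calculus is needed. Applied to `Id`, the degree `n` coefficient of
`exp(X)` is the vector field of `X_n` plus terms in lower coefficients of `X`
(`coeff_formalExp_sub_congr`). By this triangularity, exponents built from vector fields correspond
to smooth expansions starting with `Id`. So `HasExpExpansion` says that `Φ` has a smooth expansion
agreeing with the exact flow of `g` through degree `p` and exceeding it by `e` in degree `p + 1`
(`HasExpExpansion.exists_hasExpansion`, `HasExpansion.hasExpExpansion`).

The relation `Φ - Φ' = h^m e + O(h^(m+1))` is easy to propagate. Rescaling `h` to `a h` multiplies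
`e` by `a^m`. Under composition errors add, since every map involved is `Id + O(h)`
(`DiffersBy.comp`). Hence replacing the exact child flows of a node by approximate steps changes its
method by `(∑ a_j^m) e_left + (∑ b_j^m) e_right` (`DiffersBy.twoSplit`), on top of the node's own
error. Induction on the tree multiplies these sums along paths
(`HierarchicalSplitting.hasExpExpansion_step`). `IsSmoothStep.comp` supplies the expansion to all
orders needed to return to exponential form.

Convergence is the one-step argument of local error `O(h^(p+1))`, stability factor `1 + L h` and
discrete Gronwall, with both estimates read off the expansion. -/

theorem coeff_zero_pow_succ {σ : PowerSeries R} (h : coeff 0 σ = 0) (k : ℕ) :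
    coeff 0 (σ ^ (k + 1)) = 0 := by
  rw [pow_succ, coeff_mul]
  simp [h]

theorem coeff_pow_congr {σ χ : PowerSeries R} {n : ℕ} (h : ∀ j < n, coeff j σ = coeff j χ)
    (k : ℕ) : ∀ m < n, coeff m (σ ^ k) = coeff m (χ ^ k) := by
  induction k with
  | zero => simp
  | succ k ih =>
    intro m hm
    rw [pow_succ, pow_succ, coeff_mul, coeff_mul]
    refine Finset.sum_congr rfl fun ij hij => ?_
    rw [Finset.HasAntidiagonal.mem_antidiagonal] at hij
    rw [ih _ (by omega), h _ (by omega)]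

/-- With zero constant terms, a product of at least two factors uses only coefficients of degree
below `n` to produce degree `n`. -/
theorem coeff_pow_add_two_congr {σ χ : PowerSeries R} {n : ℕ} (hs : coeff 0 σ = 0)
    (hχ : coeff 0 χ = 0) (h : ∀ j < n, coeff j σ = coeff j χ) (k : ℕ) :
    coeff n (σ ^ (k + 2)) = coeff n (χ ^ (k + 2)) := by
  rw [pow_succ, pow_succ _ (k + 1), coeff_mul, coeff_mul]
  refine Finset.sum_congr rfl fun ij hij => ?_
  rw [Finset.HasAntidiagonal.mem_antidiagonal] at hij
  rcases Nat.eq_zero_or_pos ij.1 with h1 | h1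
  · rw [h1, coeff_zero_pow_succ hs, coeff_zero_pow_succ hχ, zero_mul, zero_mul]
  rcases Nat.eq_zero_or_pos ij.2 with h2 | h2
  · rw [h2, hs, hχ, mul_zero, mul_zero]
  · rw [coeff_pow_congr h _ _ (by omega), h _ (by omega)]

theorem coeff_monomial_one_pow (A : R) (k n : ℕ) :
    coeff n (monomial 1 A ^ k) = if n = k then A ^ k else 0 := by
  induction k generalizing n with
  | zero => simp [coeff_one]
  | succ k ih =>
    rw [pow_succ, coeff_mul]
    rcases n with _ | n
    · simp [coeff_monomial]
    · rw [Finset.sum_eq_single (n, 1)]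
      · by_cases h : n = k <;> simp [ih, h, pow_succ]
      · rintro ⟨i, j⟩ hij hne
        replace hij := Finset.HasAntidiagonal.mem_antidiagonal.1 hij
        have : j ≠ 1 := by
          rintro rfl
          exact hne (by simp at hij ⊢; omega)
        simp [coeff_monomial, this]
      · simp

end PowerSeries

/-! ### The formal exponential and the modified vector field -/

section FormalExponential

variable {d : ℕ}

open PowerSeries

@[simp]
theorem SmoothMap.lieDeriv_identity (g : SmoothMap d) :
    SmoothMap.lieDeriv g (SmoothMap.identity d) = g := by
  apply Subtype.ext
  funext x
  change fderiv ℝ id x (g.1 x) = g.1 x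
  simp

@[simp]
theorem SmoothMap.lieDeriv_zero : SmoothMap.lieDeriv (0 : SmoothMap d) = 0 := by
  apply LinearMap.ext
  intro u
  apply Subtype.ext
  funext x
  exact map_zero (fderiv ℝ u.1 x)

theorem coeff_formalExp_zero (X : PowerSeries (Module.End ℝ (SmoothMap d))) :
    coeff 0 (formalExp X) = 1 := by
  simp [formalExp]

/-- Triangularity of the exponential: among the powers of `X`, only the first involves the degree
`n` coefficient of `X`. -/
theorem coeff_formalExp_sub_congr {X Y : PowerSeries (Module.End ℝ (SmoothMap d))} {n : ℕ}
    (hX : coeff 0 X = 0) (hY : coeff 0 Y = 0) (h : ∀ j < n, coeff j X = coeff j Y)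
    (u : SmoothMap d) :
    coeff n (formalExp X) u - coeff n X u = coeff n (formalExp Y) u - coeff n Y u := by
  -- For `n = 0` the defining sum stops before the linear term `k = 1`, so this case is separate.
  rcases Nat.eq_zero_or_pos n with rfl | hn
  · rw [coeff_formalExp_zero, coeff_formalExp_zero, hX, hY]
  rw [sub_eq_sub_iff_sub_eq_sub]
  simp only [formalExp, coeff_mk, LinearMap.sum_apply, LinearMap.smul_apply]
  rw [← Finset.sum_sub_distrib, Finset.sum_eq_single 1]
  · simp
  · intro k _ hk
    rcases k with _ | _ | k
    · simp
    · exact absurd rfl hk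
    · rw [coeff_pow_add_two_congr hX hY h, sub_self]
  · intro h1
    exact absurd (Finset.mem_range.2 (by omega)) h1

theorem coeff_formalExp_congr {X Y : PowerSeries (Module.End ℝ (SmoothMap d))} {n : ℕ}
    (hX : coeff 0 X = 0) (hY : coeff 0 Y = 0) (h : ∀ j ≤ n, coeff j X = coeff j Y) :
    coeff n (formalExp X) = coeff n (formalExp Y) := by
  ext1 u
  have := coeff_formalExp_sub_congr hX hY (fun j hj => h j hj.le) u
  rwa [h n le_rfl, sub_left_inj] at this

theorem coeff_formalExp_monomial_one (A : Module.End ℝ (SmoothMap d)) (n : ℕ) :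
    coeff n (formalExp (monomial 1 A)) = ((n ! : ℝ)⁻¹) • A ^ n := by
  simp only [formalExp, coeff_mk, coeff_monomial_one_pow]
  rw [Finset.sum_eq_single n]
  · simp
  · intro k _ hk
    simp [hk.symm]
  · intro h
    exact absurd (Finset.mem_range.2 (Nat.lt_succ_self n)) h

/-- The coefficient of `h^k` in the Taylor expansion of the exact flow of `g`. -/
noncomputable def flowCoeff (g : SmoothMap d) (k : ℕ) : SmoothMap d :=
  ((k ! : ℝ)⁻¹) • (SmoothMap.lieDeriv g ^ k) (SmoothMap.identity d)

@[simp]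
theorem flowCoeff_zero (g : SmoothMap d) : flowCoeff g 0 = SmoothMap.identity d := by
  simp [flowCoeff]

theorem coeff_formalExp_lieDeriv_identity (g : SmoothMap d) (n : ℕ) :
    coeff n (formalExp (monomial 1 (SmoothMap.lieDeriv g))) (SmoothMap.identity d)
      = flowCoeff g n := by
  rw [coeff_formalExp_monomial_one]
  rfl

/-- The formal vector field whose exponential has the coefficients `ψ k` (the modified equation of
a one-step method with expansion `∑ k, h^k ψ k`). -/
noncomputable def modifiedField (ψ : ℕ → SmoothMap d) : ℕ → SmoothMap d
  | n => ψ n - coeff n (formalExp (mk fun k =>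
      if _h : k < n then SmoothMap.lieDeriv (modifiedField ψ k) else 0)) (SmoothMap.identity d)

theorem modifiedField_zero {ψ : ℕ → SmoothMap d} (h0 : ψ 0 = SmoothMap.identity d) :
    modifiedField ψ 0 = 0 := by
  rw [modifiedField, coeff_formalExp_zero, h0]
  simp

/-- The full exponent and its truncation below `n` differ, up to degree `n`, only in degree `n`;
there the difference acts on `Id` as the field itself, which is the defect the recursion prescribes.
-/
theorem coeff_formalExp_modifiedField {ψ : ℕ → SmoothMap d} (h0 : ψ 0 = SmoothMap.identity d)
    (n : ℕ) :
    coeff n (formalExp (mk fun k => SmoothMap.lieDeriv (modifiedField ψ k)))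
      (SmoothMap.identity d) = ψ n := by
  rcases Nat.eq_zero_or_pos n with rfl | hn
  · rw [coeff_formalExp_zero, h0]
    rfl
  have key := coeff_formalExp_sub_congr (n := n)
    (X := mk fun k => SmoothMap.lieDeriv (modifiedField ψ k))
    (Y := mk fun k => if _h : k < n then SmoothMap.lieDeriv (modifiedField ψ k) else 0)
    (by simp [modifiedField_zero h0]) (by simp [modifiedField_zero h0])
    (fun j hj => by simp [hj]) (SmoothMap.identity d)
  rw [coeff_mk, coeff_mk, dif_neg (lt_irrefl n),
    SmoothMap.lieDeriv_identity, LinearMap.zero_apply, sub_zero, sub_eq_iff_eq_add] at key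
  rw [key]
  conv_lhs => rw [modifiedField]
  abel

/-- The exponent in `HasExpExpansion`, as a single formal vector field. -/
theorem exponent_eq_mk {p : ℕ} (hp : 1 ≤ p) {g e : SmoothMap d} {r X : ℕ → SmoothMap d}
    (h0 : X 0 = 0) (h1 : X 1 = g) (hmid : ∀ k, 2 ≤ k → k ≤ p → X k = 0) (he : X (p + 1) = e)
    (hr : ∀ k, X (k + (p + 2)) = r k) :
    monomial 1 (SmoothMap.lieDeriv g) + monomial (p + 1) (SmoothMap.lieDeriv e)
      + PowerSeries.X ^ (p + 2) * mk (fun k => SmoothMap.lieDeriv (r k))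
      = mk fun k => SmoothMap.lieDeriv (X k) := by
  ext1 n
  rw [map_add, map_add, coeff_monomial, coeff_monomial, coeff_X_pow_mul', coeff_mk]
  rcases Nat.lt_or_ge n (p + 2) with hn | hn
  · rw [if_neg (c := p + 2 ≤ n) (by omega), add_zero]
    rcases n with _ | _ | n
    · simp [h0]
    · simp [h1, Nat.one_le_iff_ne_zero.1 hp]
    · rw [if_neg (by omega)]
      by_cases hnp : n + 1 + 1 = p + 1
      · rw [if_pos hnp, hnp, zero_add, coeff_mk, he]
      · rw [if_neg hnp, coeff_mk, hmid _ (by omega) (by omega), zero_add, SmoothMap.lieDeriv_zero]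
  · obtain ⟨k, rfl⟩ := Nat.exists_eq_add_of_le' hn
    rw [if_neg (by omega), if_neg (by omega), if_pos hn, coeff_mk, hr, zero_add, zero_add]
    simp

/-- Asymptotic expansion of a one-step map to all orders, locally uniformly, with smooth
coefficients. -/
def HasExpansion (Φ : ℝ → EuclideanSpace ℝ (Fin d) → EuclideanSpace ℝ (Fin d))
    (ψ : ℕ → SmoothMap d) : Prop :=
  ∀ (n : ℕ) (x₀ : EuclideanSpace ℝ (Fin d)),
    (fun z : ℝ × EuclideanSpace ℝ (Fin d) =>
      Φ z.1 z.2 - ∑ k ∈ Finset.range n, z.1 ^ k • (ψ k).1 z.2)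
      =O[𝓝 ((0 : ℝ), x₀)] (fun z => z.1 ^ n)

variable {Φ : ℝ → EuclideanSpace ℝ (Fin d) → EuclideanSpace ℝ (Fin d)} {g e : SmoothMap d} {p : ℕ}

/-- The exponent equals `h L_g` through degree `p`, so in degree `p + 1` triangularity leaves only
the linear contribution of `e`. -/
theorem HasExpExpansion.exists_hasExpansion (hp : 1 ≤ p) (h : HasExpExpansion Φ g p e) :
    ∃ ψ, HasExpansion Φ ψ ∧ (∀ k ≤ p, ψ k = flowCoeff g k) ∧
      ψ (p + 1) = flowCoeff g (p + 1) + e := by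
  obtain ⟨r, hr⟩ := h
  set S := monomial 1 (SmoothMap.lieDeriv g) + monomial (p + 1) (SmoothMap.lieDeriv e)
      + PowerSeries.X ^ (p + 2) * mk (fun k => SmoothMap.lieDeriv (r k)) with hS
  have hS0 : coeff 0 S = 0 := by
    rw [hS, map_add, map_add, coeff_monomial, coeff_monomial, coeff_X_pow_mul']
    simp
  have hM0 : coeff 0 (monomial 1 (SmoothMap.lieDeriv g)) = 0 := by simp [coeff_monomial]
  have hlow : ∀ j ≤ p, coeff j S = coeff j (monomial 1 (SmoothMap.lieDeriv g)) := by
    intro j hj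
    rw [hS, map_add, map_add, coeff_monomial (n := p + 1), coeff_X_pow_mul', if_neg (by omega),
      if_neg (by omega), add_zero, add_zero]
  refine ⟨fun k => coeff k (formalExp S) (SmoothMap.identity d), fun n x₀ => hr n x₀, ?_, ?_⟩
  · intro k hk
    change coeff k (formalExp S) (SmoothMap.identity d) = _
    rw [coeff_formalExp_congr hS0 hM0 fun j hj => hlow j (hj.trans hk),
      coeff_formalExp_lieDeriv_identity]
  · have key := coeff_formalExp_sub_congr (n := p + 1) hS0 hM0
      (fun j hj => hlow j (Nat.lt_succ_iff.1 hj)) (SmoothMap.identity d)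
    have hSp : coeff (p + 1) S = SmoothMap.lieDeriv e := by
      rw [hS, map_add, map_add, coeff_monomial, coeff_monomial_same, coeff_X_pow_mul',
        if_neg (by omega), if_neg (by omega), zero_add, add_zero]
    rw [hSp, coeff_monomial, if_neg (by omega), LinearMap.zero_apply, sub_zero, sub_eq_iff_eq_add] at key
    change coeff (p + 1) (formalExp S) (SmoothMap.identity d) = _
    rw [key, coeff_formalExp_lieDeriv_identity, SmoothMap.lieDeriv_identity]

/-- Converse translation: triangularity forces the modified field to be `g` in degree 1, zero in
degrees 2 to `p`, and `e` in degree `p + 1`. -/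
theorem HasExpansion.hasExpExpansion (hp : 1 ≤ p) {ψ : ℕ → SmoothMap d} (h : HasExpansion Φ ψ)
    (hlow : ∀ k ≤ p, ψ k = flowCoeff g k) (hlead : ψ (p + 1) = flowCoeff g (p + 1) + e) :
    HasExpExpansion Φ g p e := by
  have h0 : ψ 0 = SmoothMap.identity d := by rw [hlow 0 (Nat.zero_le _), flowCoeff_zero]
  set X := modifiedField ψ with hX
  have hX0 : X 0 = 0 := modifiedField_zero h0
  have hM0 : coeff 0 (monomial 1 (SmoothMap.lieDeriv g)) = 0 := by simp [coeff_monomial]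
  have hS0 : coeff 0 (mk fun k => SmoothMap.lieDeriv (X k)) = 0 := by simp [hX0]
  have key : ∀ n, (∀ j < n, SmoothMap.lieDeriv (X j) =
      coeff j (monomial 1 (SmoothMap.lieDeriv g))) →
      X n = ψ n - flowCoeff g n +
        coeff n (monomial 1 (SmoothMap.lieDeriv g)) (SmoothMap.identity d) := by
    intro n hn
    have := coeff_formalExp_sub_congr (n := n) hS0 hM0
      (fun j hj => by rw [coeff_mk, hn j hj]) (SmoothMap.identity d)
    rw [coeff_formalExp_lieDeriv_identity,
      coeff_formalExp_modifiedField h0, coeff_mk, SmoothMap.lieDeriv_identity] at this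
    rw [sub_eq_iff_eq_add] at this
    rw [this]
    abel
  have hagree : ∀ n ≤ p, X n = coeff n (monomial 1 (SmoothMap.lieDeriv g)) (SmoothMap.identity d)
      ∧ SmoothMap.lieDeriv (X n) = coeff n (monomial 1 (SmoothMap.lieDeriv g)) := by
    intro n
    induction n using Nat.strong_induction_on with
    | _ n ih =>
      intro hn
      have h1 := key n fun j hj => (ih j hj (by omega)).2
      rw [hlow n hn, sub_self, zero_add] at h1
      refine ⟨h1, ?_⟩
      rw [h1, coeff_monomial]
      split_ifs <;> simp
  -- The tail of the modified field is the free `O(h^(p+2))` term.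
  refine ⟨fun k => X (k + (p + 2)), ?_⟩
  rw [exponent_eq_mk hp (X := X) hX0 (by rw [(hagree 1 hp).1]; simp)
    (fun k hk hkp => by rw [(hagree k hkp).1, coeff_monomial, if_neg (by omega)]; simp)
    (by
      rw [key (p + 1) fun j hj => (hagree j (by omega)).2, hlead, coeff_monomial,
        if_neg (by omega)]
      simp)
    fun k => rfl]
  intro n x₀
  simp only [hX, coeff_formalExp_modifiedField h0]
  exact h n x₀

end FormalExponential

/-! ### Taylor's formula along integral curves and confinement for short times -/

section TaylorAlongCurves

variable {V W : Type*} [NormedAddCommGroup V] [NormedSpace ℝ V] [NormedAddCommGroup W]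
  [NormedSpace ℝ W]

/-- The derivative of a map `u` along the vector field `g`. -/
noncomputable def derivAlong (g : V → V) (u : V → W) : V → W := fun x => fderiv ℝ u x (g x)

theorem ContDiff.derivAlong {g : V → V} {u : V → W} (hg : ContDiff ℝ ∞ g) (hu : ContDiff ℝ ∞ u) :
    ContDiff ℝ ∞ (derivAlong g u) :=
  (hu.fderiv_right (m := ∞) (by simp)).clm_apply hg

theorem ContDiff.iterate_derivAlong {g : V → V} {u : V → W} (hg : ContDiff ℝ ∞ g)
    (hu : ContDiff ℝ ∞ u) (k : ℕ) : ContDiff ℝ ∞ ((_root_.derivAlong g)^[k] u) := by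
  induction k generalizing u with
  | zero => exact hu
  | succ k ih => exact ih (hg.derivAlong hu)

/-- Time differentiation turns the Taylor polynomial of `u` into the one of `derivAlong g u` with
one term fewer; this drives the induction for the remainder. -/
theorem hasDerivAt_sum_taylor (g : V → V) (u : V → W) (x : V) (n : ℕ) (s : ℝ) :
    HasDerivAt (fun s : ℝ => ∑ k ∈ Finset.range (n + 1),
        s ^ k • ((k ! : ℝ)⁻¹ • (derivAlong g)^[k] u x))
      (∑ k ∈ Finset.range n, s ^ k • ((k ! : ℝ)⁻¹ • (derivAlong g)^[k] (derivAlong g u) x)) s := by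
  simp only [Finset.sum_range_succ' _ n, pow_zero, one_smul]
  refine HasDerivAt.add_const _ (HasDerivAt.fun_sum fun k _ => ?_)
  have h := (hasDerivAt_pow (k + 1) s).smul_const
    (((k + 1)! : ℝ)⁻¹ • (derivAlong g)^[k + 1] u x)
  convert h using 1
  rw [Function.iterate_succ_apply, Nat.add_sub_cancel, smul_smul, smul_smul, Nat.factorial_succ]
  congr 1
  have : (k ! : ℝ) ≠ 0 := by positivity
  have : ((k : ℝ) + 1) ≠ 0 := by positivity
  push_cast
  field_simp

/-- Taylor's formula along integral curves that stay in a compact set, with a uniform remainder. -/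
theorem exists_norm_sub_sum_taylor_le {g : V → V} (hg : ContDiff ℝ ∞ g) {K : Set V}
    (hK : IsCompact K) (n : ℕ) {u : V → W} (hu : ContDiff ℝ ∞ u) :
    ∃ C : ℝ, 0 ≤ C ∧ ∀ (t : ℝ) (γ : ℝ → V),
      (∀ s ∈ Set.uIcc 0 t, HasDerivWithinAt γ (g (γ s)) (Set.uIcc 0 t) s) →
      (∀ s ∈ Set.uIcc 0 t, γ s ∈ K) →
      ‖u (γ t) - ∑ k ∈ Finset.range n, t ^ k • ((k ! : ℝ)⁻¹ • (derivAlong g)^[k] u (γ 0))‖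
        ≤ C * |t| ^ n := by
  induction n generalizing u with
  | zero =>
    obtain ⟨C, hC⟩ := hK.exists_bound_of_continuousOn hu.continuous.continuousOn
    refine ⟨max C 0, le_max_right _ _, fun t γ _ hγK => ?_⟩
    simpa using Or.inl (hC _ (hγK t Set.right_mem_uIcc))
  | succ n ih =>
    obtain ⟨C, hC0, hC⟩ := ih (hg.derivAlong hu)
    refine ⟨C, hC0, fun t γ hγ hγK => ?_⟩
    have hder : ∀ s ∈ Set.uIcc 0 t, HasDerivWithinAt
        (fun s => u (γ s) - ∑ k ∈ Finset.range (n + 1),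
          s ^ k • ((k ! : ℝ)⁻¹ • (derivAlong g)^[k] u (γ 0)))
        (derivAlong g u (γ s) - ∑ k ∈ Finset.range n,
          s ^ k • ((k ! : ℝ)⁻¹ • (derivAlong g)^[k] (derivAlong g u) (γ 0)))
        (Set.uIcc 0 t) s := fun s hs =>
      (((hu.differentiable (by simp)) (γ s)).hasFDerivAt.comp_hasDerivWithinAt s (hγ s hs)).sub
        (hasDerivAt_sum_taylor g u (γ 0) n s).hasDerivWithinAt
    have hbound : ∀ s ∈ Set.uIcc 0 t, ‖derivAlong g u (γ s) - ∑ k ∈ Finset.range n,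
          s ^ k • ((k ! : ℝ)⁻¹ • (derivAlong g)^[k] (derivAlong g u) (γ 0))‖ ≤ C * |t| ^ n := by
      intro s hs
      have hsub : Set.uIcc 0 s ⊆ Set.uIcc 0 t := Set.uIcc_subset_uIcc_left hs
      -- The inductive bound is used at every intermediate time `s`, with the curve restricted to
      -- the segment from 0 to `s`; the mean value inequality then gains a factor `|t|`.
      refine (hC s γ (fun r hr => (hγ r (hsub hr)).mono hsub) fun r hr => hγK r (hsub hr)).trans ?_
      have hst : |s| ≤ |t| := by simpa using Set.abs_sub_left_of_mem_uIcc hs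
      gcongr
    have := (convex_uIcc (𝕜 := ℝ) 0 t).norm_image_sub_le_of_norm_hasDerivWithin_le hder hbound
      Set.left_mem_uIcc Set.right_mem_uIcc
    have h0 : ∑ k ∈ Finset.range (n + 1),
        (0 : ℝ) ^ k • ((k ! : ℝ)⁻¹ • (derivAlong g)^[k] u (γ 0)) = u (γ 0) := by
      rw [Finset.sum_range_succ']
      simp
    rw [h0, sub_self, sub_zero, sub_zero, Real.norm_eq_abs, mul_assoc, ← pow_succ] at this
    exact this

/-- Fencing by the barrier `1/2 + M s`: the speed bound is only needed where the distance equals the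
barrier, hence inside the ball, so confinement need not be assumed. The strict inequality in `hM` is
what forbids crossing. -/
theorem norm_sub_le_of_hasDerivWithinAt_Icc {g : V → V} {x₀ : V} {M t : ℝ} {γ : ℝ → V}
    (hM : ∀ x ∈ Metric.closedBall x₀ 1, ‖g x‖ < M)
    (hγ : ∀ s ∈ Set.Icc 0 t, HasDerivWithinAt γ (g (γ s)) (Set.Icc 0 t) s)
    (h0 : ‖γ 0 - x₀‖ ≤ 1 / 2) (ht : M * t ≤ 1 / 2) :
    ∀ s ∈ Set.Icc 0 t, ‖γ s - x₀‖ ≤ 1 := by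
  have hMpos : 0 < M := (norm_nonneg _).trans_lt (hM x₀ (by simp))
  have hB : ∀ s ∈ Set.Icc 0 t, 1 / 2 + M * s ≤ 1 := by
    intro s hs
    have := mul_le_mul_of_nonneg_left hs.2 hMpos.le
    linarith
  have key := image_norm_le_of_norm_deriv_right_lt_deriv_boundary (a := 0) (b := t)
    (f := fun s => γ s - x₀) (f' := fun s => g (γ s)) (B := fun s => 1 / 2 + M * s)
    (B' := fun _ => M)
    (fun s hs => ((hγ s hs).sub_const x₀).continuousWithinAt)
    (fun s hs => ((hγ s (Set.Ico_subset_Icc_self hs)).sub_const x₀).mono_of_mem_nhdsWithin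
      (Icc_mem_nhdsGE_of_mem hs))
    (by simpa using h0)
    (fun s => by simpa using ((hasDerivAt_id s).const_mul M).const_add (1 / 2))
    (fun s hs hs' => hM _ (by
      rw [Metric.mem_closedBall, dist_eq_norm, hs']
      exact hB s (Set.Ico_subset_Icc_self hs)))
  exact fun s hs => (key hs).trans (hB s hs)

theorem mem_closedBall_of_hasDerivWithinAt_uIcc {g : V → V} {x₀ : V} {M t : ℝ} {γ : ℝ → V}
    (hM : ∀ x ∈ Metric.closedBall x₀ 1, ‖g x‖ < M)
    (hγ : ∀ s ∈ Set.uIcc 0 t, HasDerivWithinAt γ (g (γ s)) (Set.uIcc 0 t) s)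
    (h0 : ‖γ 0 - x₀‖ ≤ 1 / 2) (ht : M * |t| ≤ 1 / 2) :
    ∀ s ∈ Set.uIcc 0 t, γ s ∈ Metric.closedBall x₀ 1 := by
  intro s hs
  rw [Metric.mem_closedBall, dist_eq_norm]
  rcases le_total 0 t with h | h
  · rw [Set.uIcc_of_le h] at hγ hs
    rw [abs_of_nonneg h] at ht
    exact norm_sub_le_of_hasDerivWithinAt_Icc hM hγ h0 ht s hs
  · rw [Set.uIcc_of_ge h] at hγ hs
    rw [abs_of_nonpos h] at ht
    -- Negative times reduce to positive ones by reversing time and the sign of the field.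
    have hγ' : ∀ s ∈ Set.Icc 0 (-t), HasDerivWithinAt (fun s => γ (-s)) (-g (γ (-s)))
        (Set.Icc 0 (-t)) s := by
      intro s hs
      have hs' : -s ∈ Set.Icc t 0 := ⟨by linarith [hs.2], by linarith [hs.1]⟩
      have := (hγ (-s) hs').scomp s (hasDerivAt_neg s).hasDerivWithinAt
        (t' := Set.Icc t 0) (s := Set.Icc 0 (-t))
        fun r hr => ⟨by linarith [hr.2], by linarith [hr.1]⟩
      simpa [Function.comp_def] using this
    have := norm_sub_le_of_hasDerivWithinAt_Icc (g := fun x => -g x) (x₀ := x₀)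
      (by simpa using hM) hγ' (by simpa using h0) ht (-s)
      ⟨by linarith [hs.2], by linarith [hs.1]⟩
    simpa using this

end TaylorAlongCurves

/-! ### Expansion of the exact flow -/

section Expansions

variable {d : ℕ}

theorem SmoothMap.coe_lieDeriv_pow (g : SmoothMap d) (k : ℕ) (u : SmoothMap d) :
    ((SmoothMap.lieDeriv g ^ k) u).1 = (derivAlong g.1)^[k] u.1 := by
  induction k generalizing u with
  | zero => rfl
  | succ k ih =>
    rw [pow_succ, Module.End.mul_apply, ih, Function.iterate_succ_apply]
    rfl

theorem coe_flowCoeff (g : SmoothMap d) (k : ℕ) (x : EuclideanSpace ℝ (Fin d)) :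
    (flowCoeff g k).1 x = (k ! : ℝ)⁻¹ • (derivAlong g.1)^[k] id x := by
  rw [flowCoeff]
  change (k ! : ℝ)⁻¹ • ((SmoothMap.lieDeriv g ^ k) (SmoothMap.identity d)).1 x = _
  rw [SmoothMap.coe_lieDeriv_pow]
  rfl

/-- The exact flow is expanded by the exponential series of the Lie derivative. -/
theorem hasExpansion_exactFlow (g : SmoothMap d) : HasExpansion (exactFlow g) (flowCoeff g) := by
  intro n x₀
  have hg : ContDiff ℝ ∞ g.1 := g.2
  obtain ⟨C, -, hC⟩ := exists_norm_sub_sum_taylor_le hg (isCompact_closedBall x₀ 1) n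
    (contDiff_id (𝕜 := ℝ) (E := EuclideanSpace ℝ (Fin d)) (n := ∞))
  obtain ⟨M, hM⟩ := (isCompact_closedBall x₀ 1).exists_bound_of_continuousOn
    hg.continuous.continuousOn
  obtain ⟨r, hr, ε, hε, hex⟩ :=
    (hg.contDiffAt (x := x₀)).of_le (m := 1) (by simp)
      |>.exists_forall_mem_closedBall_exists_eq_forall_mem_Ioo_hasDerivAt 0
  refine IsBigO.of_bound C ?_
  rw [nhds_prod_eq]
  have ht1 : ∀ᶠ t : ℝ in 𝓝 0, |t| < ε := by
    filter_upwards [Metric.ball_mem_nhds (0 : ℝ) hε] with t ht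
    simpa using ht
  have ht2 : ∀ᶠ t : ℝ in 𝓝 0, (M + 1) * |t| ≤ 1 / 2 := by
    have : Tendsto (fun t : ℝ => (M + 1) * |t|) (𝓝 0) (𝓝 ((M + 1) * |0|)) :=
      (continuous_const.mul continuous_abs).tendsto 0
    rw [abs_zero, mul_zero] at this
    exact this.eventually_le_const (by norm_num)
  have hx1 := Metric.closedBall_mem_nhds x₀ hr
  have hx2 := Metric.closedBall_mem_nhds x₀ (by norm_num : (0 : ℝ) < 1 / 2)
  filter_upwards [prod_mem_prod (ht1.and ht2) (inter_mem hx1 hx2)] with z hz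
  obtain ⟨⟨h1, h2⟩, h3, h4⟩ := hz
  -- Picard–Lindelöf gives one existence time for all starting points near `x₀`, so `exactFlow` is
  -- not at its default value here. Uniqueness plays no role: confinement and Taylor's formula apply
  -- to whichever solution is chosen.
  have H : ∃ γ : ℝ → EuclideanSpace ℝ (Fin d), γ 0 = z.2 ∧
      IsIntegralCurveOn γ (fun _ => g.1) (Set.uIcc 0 z.1) := by
    obtain ⟨α, hα0, hα⟩ := hex z.2 h3
    refine ⟨α, hα0, fun t ht => (hα t ?_).hasDerivWithinAt⟩
    have := Set.abs_sub_left_of_mem_uIcc ht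
    rw [sub_zero, sub_zero] at this
    simpa [← abs_lt] using this.trans_lt h1
  rw [exactFlow, dif_pos H]
  obtain ⟨hγ0, hγ⟩ := H.choose_spec
  set γ := H.choose
  have hmem := mem_closedBall_of_hasDerivWithinAt_uIcc (g := g.1) (x₀ := x₀) (M := M + 1) (t := z.1)
    (γ := γ) (fun x hx => (hM x hx).trans_lt (lt_add_one M)) hγ
    (by rw [hγ0, ← dist_eq_norm]; exact h4) h2
  have := hC z.1 γ hγ hmem
  rw [hγ0] at this
  simpa only [coe_flowCoeff, norm_pow, Real.norm_eq_abs, id] using this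

end Expansions

/-! ### Local Lipschitz bounds and uniqueness of expansion coefficients -/

section LocalLipschitz

variable {V W ι : Type*} [NormedAddCommGroup V] [NormedSpace ℝ V] [NormedAddCommGroup W]
  [NormedSpace ℝ W]

theorem ContDiff.isBigO_sub_of_tendsto {G : V → W} (hG : ContDiff ℝ ∞ G) {l : Filter ι}
    {u v : ι → V} {p : V} (hu : Tendsto u l (𝓝 p)) (hv : Tendsto v l (𝓝 p)) :
    (fun i => G (u i) - G (v i)) =O[l] fun i => u i - v i := by
  obtain ⟨K, s, hs, hK⟩ := ((hG.contDiffAt (x := p)).of_le (m := 1) (by simp)).exists_lipschitzOnWith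
  refine IsBigO.of_bound K ?_
  filter_upwards [hu hs, hv hs] with i h1 h2
  exact hK.norm_sub_le h1 h2

/-- The limit `t → 0` kills `c 0`; dividing by `t`, allowed in the punctured neighbourhood, lowers
the degree. -/
theorem eq_zero_of_sum_pow_smul_isBigO {n : ℕ} {c : ℕ → W}
    (h : (fun t : ℝ => ∑ k ∈ Finset.range n, t ^ k • c k) =O[𝓝[≠] 0] fun t => t ^ n) :
    ∀ k < n, c k = 0 := by
  induction n generalizing c with
  | zero => simp
  | succ n ih =>
    have h0 : c 0 = 0 := by
      have h1 : Tendsto (fun t : ℝ => ∑ k ∈ Finset.range (n + 1), t ^ k • c k) (𝓝[≠] 0)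
          (𝓝 (∑ k ∈ Finset.range (n + 1), (0 : ℝ) ^ k • c k)) :=
        ((by fun_prop : Continuous fun t : ℝ => ∑ k ∈ Finset.range (n + 1), t ^ k • c k).tendsto
          0).mono_left nhdsWithin_le_nhds
      have h2 : Tendsto (fun t : ℝ => t ^ (n + 1)) (𝓝[≠] 0) (𝓝 0) := by
        have := ((continuous_pow (M := ℝ) (n + 1)).tendsto 0).mono_left
          (nhdsWithin_le_nhds (s := {0}ᶜ))
        simpa using this
      have h3 := tendsto_nhds_unique h1 (h.trans_tendsto h2)
      simpa [Finset.sum_range_succ'] using h3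
    have hshift : (fun t : ℝ => ∑ k ∈ Finset.range n, t ^ k • c (k + 1)) =O[𝓝[≠] 0]
        fun t => t ^ n := by
      obtain ⟨C, hC⟩ := h.bound
      refine IsBigO.of_bound C ?_
      filter_upwards [hC, self_mem_nhdsWithin] with t ht ht0
      have hpos : 0 < ‖t‖ := norm_pos_iff.2 ht0
      have hsum : ∑ k ∈ Finset.range (n + 1), t ^ k • c k
          = t • ∑ k ∈ Finset.range n, t ^ k • c (k + 1) := by
        rw [Finset.sum_range_succ', h0, smul_zero, add_zero, Finset.smul_sum]
        exact Finset.sum_congr rfl fun k _ => by rw [smul_smul, pow_succ']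
      rw [hsum, norm_smul, pow_succ', norm_mul, mul_left_comm] at ht
      exact le_of_mul_le_mul_left ht hpos
    intro k hk
    rcases k with _ | k
    · exact h0
    · exact ih hshift k (by omega)

end LocalLipschitz

/-! ### Smooth one-step maps: composition and propagation of differences -/

section Expansions

variable {d : ℕ}

theorem isBigO_pow_of_le {ι : Type*} {l : Filter ι} {t : ι → ℝ} (ht : Tendsto t l (𝓝 0))
    {m n : ℕ} (hmn : m ≤ n) : (fun i => t i ^ n) =O[l] fun i => t i ^ m := by
  obtain ⟨k, rfl⟩ := Nat.exists_eq_add_of_le hmn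
  have h1 : (fun i => t i ^ k) =O[l] fun _ => (1 : ℝ) := (ht.pow k).isBigO_one ℝ
  simpa [pow_add] using (isBigO_refl (fun i => t i ^ m) l).mul h1

theorem SmoothMap.contDiff_sum_pow_smul (ψ : ℕ → SmoothMap d) (s : Finset ℕ) :
    ContDiff ℝ ∞ fun z : ℝ × EuclideanSpace ℝ (Fin d) => ∑ k ∈ s, z.1 ^ k • (ψ k).1 z.2 :=
  ContDiff.sum fun k _ => (contDiff_fst.pow k).smul ((SmoothMap.contDiff_coe (ψ k)).comp contDiff_snd)

theorem eq_of_expansion {Φ : ℝ → EuclideanSpace ℝ (Fin d) → EuclideanSpace ℝ (Fin d)}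
    {ψ χ : ℕ → SmoothMap d} {n : ℕ}
    (hψ : ∀ x₀, (fun z : ℝ × EuclideanSpace ℝ (Fin d) =>
      Φ z.1 z.2 - ∑ k ∈ Finset.range n, z.1 ^ k • (ψ k).1 z.2) =O[𝓝 (0, x₀)] fun z => z.1 ^ n)
    (hχ : ∀ x₀, (fun z : ℝ × EuclideanSpace ℝ (Fin d) =>
      Φ z.1 z.2 - ∑ k ∈ Finset.range n, z.1 ^ k • (χ k).1 z.2) =O[𝓝 (0, x₀)] fun z => z.1 ^ n) :
    ∀ k < n, ψ k = χ k := by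
  intro k hk
  apply Subtype.ext
  funext x
  have hlim : Tendsto (fun t : ℝ => (t, x)) (𝓝[≠] 0) (𝓝 (0, x)) :=
    ((Continuous.prodMk_left x).tendsto 0).mono_left nhdsWithin_le_nhds
  have h := ((hχ x).sub (hψ x)).comp_tendsto hlim
  refine sub_eq_zero.1 (eq_zero_of_sum_pow_smul_isBigO
    (c := fun k => (ψ k).1 x - (χ k).1 x) (h.congr_left fun t => ?_) k hk)
  simp [smul_sub]

/-- Expansion in `h` is Taylor's formula along the constant field `(1, 0)` on `ℝ × ℝ^d`, whose
integral curves are `s ↦ (s, x)`. -/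
theorem exists_hasExpansion_of_contDiff {F : ℝ × EuclideanSpace ℝ (Fin d) → EuclideanSpace ℝ (Fin d)}
    (hF : ContDiff ℝ ∞ F) : ∃ ψ, HasExpansion (fun h x => F (h, x)) ψ := by
  set e : ℝ × EuclideanSpace ℝ (Fin d) → ℝ × EuclideanSpace ℝ (Fin d) := fun _ => (1, 0)
  have he : ContDiff ℝ ∞ e := contDiff_const
  refine ⟨fun k => ⟨fun x => (k ! : ℝ)⁻¹ • (derivAlong e)^[k] F (0, x),
    ((he.iterate_derivAlong hF k).comp (contDiff_prodMk_right (0 : ℝ))).const_smul _⟩, ?_⟩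
  intro n x₀
  obtain ⟨C, -, hC⟩ := exists_norm_sub_sum_taylor_le he (isCompact_closedBall ((0 : ℝ), x₀) 1) n hF
  refine IsBigO.of_bound C ?_
  filter_upwards [Metric.closedBall_mem_nhds ((0 : ℝ), x₀) one_pos] with z hz
  have hz1 : |z.1| ≤ 1 := by
    have := (norm_fst_le (z - (0, x₀))).trans (mem_closedBall_iff_norm.1 hz)
    simpa using this
  have := hC z.1 (fun s => (s, z.2))
    (fun s _ => ((hasDerivAt_id s).prodMk (hasDerivAt_const s z.2)).hasDerivWithinAt)
    (fun s hs => by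
      have h1 : |s| ≤ |z.1| := by simpa using Set.abs_sub_left_of_mem_uIcc hs
      rw [mem_closedBall_iff_norm, Prod.norm_def] at hz ⊢
      refine max_le ?_ ((le_max_right _ _).trans hz)
      simpa using h1.trans hz1)
  simpa only [norm_pow, Real.norm_eq_abs] using this

/-- By uniqueness, approximations of different orders share their low coefficients. The diagonal
choice takes degree `k` from the approximation of order `k + 1`, the first that determines it. -/
theorem exists_hasExpansion_of_approx {Φ : ℝ → EuclideanSpace ℝ (Fin d) → EuclideanSpace ℝ (Fin d)}
    (h : ∀ n : ℕ, ∃ F : ℝ × EuclideanSpace ℝ (Fin d) → EuclideanSpace ℝ (Fin d), ContDiff ℝ ∞ F ∧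
      ∀ x₀, (fun z : ℝ × EuclideanSpace ℝ (Fin d) => Φ z.1 z.2 - F z) =O[𝓝 (0, x₀)]
        fun z => z.1 ^ n) :
    ∃ ψ, HasExpansion Φ ψ := by
  choose F hF hΦ using h
  choose ψ hψ using fun n => exists_hasExpansion_of_contDiff (hF n)
  have key : ∀ n m, n ≤ m → ∀ x₀, (fun z : ℝ × EuclideanSpace ℝ (Fin d) =>
      Φ z.1 z.2 - ∑ k ∈ Finset.range n, z.1 ^ k • (ψ m k).1 z.2) =O[𝓝 (0, x₀)]
        fun z => z.1 ^ n := by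
    intro n m hnm x₀
    have h1 := (hΦ m x₀).trans (isBigO_pow_of_le (continuous_fst.tendsto ((0 : ℝ), x₀)) hnm)
    exact (h1.add (hψ m n x₀)).congr_left fun z => by abel
  refine ⟨fun k => ψ (k + 1) k, fun n x₀ => (key n n le_rfl x₀).congr_left fun z => ?_⟩
  congr 1
  refine Finset.sum_congr rfl fun k hk => ?_
  have hkn : k + 1 ≤ n := Finset.mem_range.1 hk
  rw [eq_of_expansion (key (k + 1) n hkn) (key (k + 1) (k + 1) le_rfl) k (Nat.lt_succ_self k)]

/-- A one-step map with a smooth asymptotic expansion that starts with the identity. -/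
def IsSmoothStep (Φ : ℝ → EuclideanSpace ℝ (Fin d) → EuclideanSpace ℝ (Fin d)) : Prop :=
  ∃ ψ, HasExpansion Φ ψ ∧ ψ 0 = SmoothMap.identity d

variable {Φ Φ' Ψ Ψ' : ℝ → EuclideanSpace ℝ (Fin d) → EuclideanSpace ℝ (Fin d)}
  {ψ χ : ℕ → SmoothMap d}

/-- The neighbourhoods in `HasExpansion` are not punctured, so the bound for `n = 1` holds at `h =
0`, where it vanishes. -/
theorem HasExpansion.apply_zero (h : HasExpansion Φ ψ) (x : EuclideanSpace ℝ (Fin d)) :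
    Φ 0 x = (ψ 0).1 x := by
  obtain ⟨C, hC⟩ := (h 1 x).bound
  simpa [sub_eq_zero] using hC.self_of_nhds

theorem HasExpansion.isSmoothStep (h : HasExpansion Φ ψ) (h0 : ∀ x, Φ 0 x = x) :
    IsSmoothStep Φ :=
  ⟨ψ, h, Subtype.ext (funext fun x => (h.apply_zero x).symm.trans (h0 x))⟩

theorem IsSmoothStep.apply_zero (h : IsSmoothStep Φ) (x : EuclideanSpace ℝ (Fin d)) :
    Φ 0 x = x := by
  obtain ⟨ψ, h, h0⟩ := h
  rw [h.apply_zero, h0]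
  rfl

theorem IsSmoothStep.isBigO_sub_id (h : IsSmoothStep Φ) (x₀ : EuclideanSpace ℝ (Fin d)) :
    (fun z : ℝ × EuclideanSpace ℝ (Fin d) => Φ z.1 z.2 - z.2) =O[𝓝 (0, x₀)] fun z => z.1 := by
  obtain ⟨ψ, h, h0⟩ := h
  refine (h 1 x₀).congr (fun z => ?_) fun z => pow_one _
  simp [h0, SmoothMap.identity]

theorem IsSmoothStep.tendsto (h : IsSmoothStep Φ) (x₀ : EuclideanSpace ℝ (Fin d)) :
    Tendsto (fun z : ℝ × EuclideanSpace ℝ (Fin d) => Φ z.1 z.2) (𝓝 (0, x₀)) (𝓝 x₀) := by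
  have h1 := (h.isBigO_sub_id x₀).trans_tendsto (continuous_fst.tendsto ((0 : ℝ), x₀))
  simpa using h1.add (continuous_snd.tendsto ((0 : ℝ), x₀))

theorem isSmoothStep_exactFlow (g : SmoothMap d) : IsSmoothStep (exactFlow g) :=
  ⟨_, hasExpansion_exactFlow g, flowCoeff_zero g⟩

theorem isSmoothStep_id : IsSmoothStep fun _ (x : EuclideanSpace ℝ (Fin d)) => x := by
  obtain ⟨ψ, h⟩ := exists_hasExpansion_of_contDiff
    (contDiff_snd (𝕜 := ℝ) (E := ℝ) (F := EuclideanSpace ℝ (Fin d)))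
  exact h.isSmoothStep fun _ => rfl

theorem tendsto_mul_left_prod (a : ℝ) (x₀ : EuclideanSpace ℝ (Fin d)) :
    Tendsto (fun z : ℝ × EuclideanSpace ℝ (Fin d) => (a * z.1, z.2)) (𝓝 (0, x₀)) (𝓝 (0, x₀)) := by
  have := (by fun_prop : Continuous fun z : ℝ × EuclideanSpace ℝ (Fin d) =>
    (a * z.1, z.2)).tendsto (0, x₀)
  simpa using this

theorem IsSmoothStep.comp_mul_left (h : IsSmoothStep Φ) (a : ℝ) :
    IsSmoothStep fun h => Φ (a * h) := by
  obtain ⟨ψ, h, h0⟩ := h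
  refine ⟨fun k => a ^ k • ψ k, fun n x₀ => ?_, by simpa using h0⟩
  have h1 := (h n x₀).comp_tendsto (tendsto_mul_left_prod a x₀)
  refine (h1.trans ?_).congr_left fun z => ?_
  · simp only [Function.comp_def, mul_pow]
    exact isBigO_const_mul_self _ _ _
  · simp only [Function.comp_apply, mul_pow]
    congr 1
    refine Finset.sum_congr rfl fun k _ => ?_
    change _ = z.1 ^ k • a ^ k • (ψ k).1 z.2
    rw [smul_smul, mul_comm]

/-- Composing truncated expansions gives a smooth map of `(h, x)` close to the true composition to
any prescribed order. The maps themselves need not be smooth. -/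
theorem IsSmoothStep.comp (hΨ : IsSmoothStep Ψ) (hΦ : IsSmoothStep Φ) :
    IsSmoothStep fun h x => Ψ h (Φ h x) := by
  have hzero : ∀ x, Ψ 0 (Φ 0 x) = x := fun x => by rw [hΦ.apply_zero, hΨ.apply_zero]
  have hΦt := hΦ.tendsto
  obtain ⟨ψ, hψ, hψ0⟩ := hΦ
  obtain ⟨χ, hχ, -⟩ := hΨ
  suffices ∃ c, HasExpansion (fun h x => Ψ h (Φ h x)) c by
    obtain ⟨c, hc⟩ := this
    exact hc.isSmoothStep hzero
  refine exists_hasExpansion_of_approx fun n => ?_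
  -- With `n + 1` terms the constant term is present even for `n = 0`, so that `F (0, x₀) = x₀`.
  set F := fun z : ℝ × EuclideanSpace ℝ (Fin d) =>
    ∑ k ∈ Finset.range (n + 1), z.1 ^ k • (ψ k).1 z.2 with hFdef
  set G := fun z : ℝ × EuclideanSpace ℝ (Fin d) =>
    ∑ k ∈ Finset.range (n + 1), z.1 ^ k • (χ k).1 z.2 with hGdef
  have hF : ContDiff ℝ ∞ F := SmoothMap.contDiff_sum_pow_smul ψ _
  have hG : ContDiff ℝ ∞ G := SmoothMap.contDiff_sum_pow_smul χ _
  refine ⟨fun z => G (z.1, F z), hG.comp (contDiff_fst.prodMk hF), fun x₀ => ?_⟩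
  have hF0 : F (0, x₀) = x₀ := by
    simp [hFdef, Finset.sum_range_succ', hψ0, SmoothMap.identity]
  have hfst := continuous_fst.tendsto ((0 : ℝ), x₀)
  have ht1 : Tendsto (fun z : ℝ × EuclideanSpace ℝ (Fin d) => (z.1, Φ z.1 z.2)) (𝓝 (0, x₀))
      (𝓝 (0, x₀)) := hfst.prodMk_nhds (hΦt x₀)
  have ht2 : Tendsto (fun z : ℝ × EuclideanSpace ℝ (Fin d) => (z.1, F z)) (𝓝 (0, x₀))
      (𝓝 (0, x₀)) := by
    have := hF.continuous.tendsto ((0 : ℝ), x₀)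
    rw [hF0] at this
    exact hfst.prodMk_nhds this
  have h1 := (hχ (n + 1) x₀).comp_tendsto ht1
  have h2 : (fun z : ℝ × EuclideanSpace ℝ (Fin d) => G (z.1, Φ z.1 z.2) - G (z.1, F z))
      =O[𝓝 (0, x₀)] fun z => z.1 ^ (n + 1) := by
    refine (hG.isBigO_sub_of_tendsto ht1 ht2).trans (IsBigO.trans ?_ (hψ (n + 1) x₀))
    refine IsBigO.of_bound 1 (Eventually.of_forall fun z => ?_)
    simp [Prod.norm_def, hFdef]
  refine ((h1.add h2).trans (isBigO_pow_of_le hfst n.le_succ)).congr_left fun z => ?_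
  simp [hGdef]

/-- The one-step maps `Φ` and `Φ'` differ by `h^m e + O(h^(m+1))`, locally uniformly. -/
def DiffersBy (Φ Φ' : ℝ → EuclideanSpace ℝ (Fin d) → EuclideanSpace ℝ (Fin d)) (m : ℕ)
    (e : SmoothMap d) : Prop :=
  ∀ x₀ : EuclideanSpace ℝ (Fin d), (fun z : ℝ × EuclideanSpace ℝ (Fin d) =>
    Φ z.1 z.2 - Φ' z.1 z.2 - z.1 ^ m • e.1 z.2) =O[𝓝 (0, x₀)] fun z => z.1 ^ (m + 1)

theorem HasExpansion.differsBy {m : ℕ} {e : SmoothMap d} (hΦ : HasExpansion Φ ψ)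
    (hΦ' : HasExpansion Φ' χ) (hlow : ∀ k < m, ψ k = χ k) (hm : ψ m = χ m + e) :
    DiffersBy Φ Φ' m e := by
  intro x₀
  refine ((hΦ (m + 1) x₀).sub (hΦ' (m + 1) x₀)).congr_left fun z => ?_
  have : ∑ k ∈ Finset.range m, z.1 ^ k • (ψ k).1 z.2
      = ∑ k ∈ Finset.range m, z.1 ^ k • (χ k).1 z.2 :=
    Finset.sum_congr rfl fun k hk => by rw [hlow k (Finset.mem_range.1 hk)]
  rw [Finset.sum_range_succ, Finset.sum_range_succ, this, hm]
  change _ - (_ + z.1 ^ m • ((χ m).1 z.2 + e.1 z.2)) - _ = _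
  rw [smul_add]
  abel

theorem DiffersBy.coeff_eq {m : ℕ} {e : SmoothMap d} (h : DiffersBy Φ Φ' m e)
    (hΦ : HasExpansion Φ ψ) (hΦ' : HasExpansion Φ' χ) :
    (∀ k < m, ψ k = χ k) ∧ ψ m = χ m + e := by
  have key := eq_of_expansion (n := m + 1) (χ := fun k => if k = m then χ m + e else χ k)
    (hΦ (m + 1)) fun x₀ => by
      refine ((h x₀).add (hΦ' (m + 1) x₀)).congr_left fun z => ?_
      have : ∑ k ∈ Finset.range m, z.1 ^ k • (if k = m then χ m + e else χ k).1 z.2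
          = ∑ k ∈ Finset.range m, z.1 ^ k • (χ k).1 z.2 :=
        Finset.sum_congr rfl fun k hk => by rw [if_neg (Finset.mem_range.1 hk).ne]
      rw [Finset.sum_range_succ, Finset.sum_range_succ, this, if_pos rfl]
      change _ = _ - (_ + z.1 ^ m • ((χ m).1 z.2 + e.1 z.2))
      rw [smul_add]
      abel
  refine ⟨fun k hk => ?_, ?_⟩
  · rw [key k (by omega), if_neg hk.ne]
  · rw [key m (by omega), if_pos rfl]

theorem DiffersBy.comp_mul_left {m : ℕ} {e : SmoothMap d} (h : DiffersBy Φ Φ' m e) (a : ℝ) :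
    DiffersBy (fun h => Φ (a * h)) (fun h => Φ' (a * h)) m (a ^ m • e) := by
  intro x₀
  have h1 := (h x₀).comp_tendsto (tendsto_mul_left_prod a x₀)
  refine (h1.trans ?_).congr_left fun z => ?_
  · simp only [Function.comp_def, mul_pow]
    exact isBigO_const_mul_self _ _ _
  · simp only [Function.comp_apply, mul_pow]
    change _ = _ - z.1 ^ m • a ^ m • e.1 z.2
    rw [smul_smul, mul_comm (a ^ m)]

theorem differsBy_self (Φ : ℝ → EuclideanSpace ℝ (Fin d) → EuclideanSpace ℝ (Fin d)) (m : ℕ) :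
    DiffersBy Φ Φ m 0 := by
  intro x₀
  refine (isBigO_zero _ _).congr_left fun z => ?_
  change _ = Φ z.1 z.2 - Φ z.1 z.2 - z.1 ^ m • (0 : EuclideanSpace ℝ (Fin d))
  simp

theorem DiffersBy.isBigO_sub {m : ℕ} {e : SmoothMap d} (h : DiffersBy Φ Φ' m e)
    (x₀ : EuclideanSpace ℝ (Fin d)) :
    (fun z : ℝ × EuclideanSpace ℝ (Fin d) => Φ z.1 z.2 - Φ' z.1 z.2) =O[𝓝 (0, x₀)]
      fun z => z.1 ^ m := by
  have hfst := continuous_fst.tendsto ((0 : ℝ), x₀)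
  have he : (fun z : ℝ × EuclideanSpace ℝ (Fin d) => e.1 z.2) =O[𝓝 (0, x₀)] fun _ => (1 : ℝ) :=
    (((SmoothMap.contDiff_coe e).continuous.comp continuous_snd).tendsto ((0 : ℝ), x₀)).isBigO_one ℝ
  have h1 := (isBigO_refl (fun z : ℝ × EuclideanSpace ℝ (Fin d) => z.1 ^ m) (𝓝 (0, x₀))).smul he
  simp only [smul_eq_mul, mul_one] at h1
  exact (((h x₀).trans (isBigO_pow_of_le hfst m.le_succ)).add h1).congr_left fun z => by abel

/-- Insert `Ψ'(Φ)`. In `Ψ(Φ) - Ψ'(Φ)` the field `e'` is evaluated at `x + O(h)`, which costs one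
order. In `Ψ'(Φ) - Ψ'(Φ')` write `Ψ' = Id + h Q + O(h^(m+1))` with `Q` smooth: the identity
transmits `h^m e`, and `h Q` adds only `O(h^(m+1))`. -/
theorem DiffersBy.comp {m : ℕ} (hm : 1 ≤ m) {e e' : SmoothMap d} (hΨ : DiffersBy Ψ Ψ' m e')
    (hΦ : DiffersBy Φ Φ' m e) (hΨ' : IsSmoothStep Ψ') (hΦ' : IsSmoothStep Φ') :
    DiffersBy (fun h x => Ψ h (Φ h x)) (fun h x => Ψ' h (Φ' h x)) m (e + e') := by
  intro x₀
  have hfst := continuous_fst.tendsto ((0 : ℝ), x₀)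
  have hB := hΦ'.tendsto x₀
  have hAB := hΦ.isBigO_sub x₀
  have hAB1 : (fun z : ℝ × EuclideanSpace ℝ (Fin d) => Φ z.1 z.2 - Φ' z.1 z.2) =O[𝓝 (0, x₀)]
      fun z => z.1 := by
    simpa using hAB.trans (isBigO_pow_of_le hfst hm)
  have hA : Tendsto (fun z : ℝ × EuclideanSpace ℝ (Fin d) => Φ z.1 z.2) (𝓝 (0, x₀)) (𝓝 x₀) := by
    simpa using (hAB1.trans_tendsto hfst).add hB
  have hAx : (fun z : ℝ × EuclideanSpace ℝ (Fin d) => Φ z.1 z.2 - z.2) =O[𝓝 (0, x₀)]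
      fun z => z.1 := by
    simpa using hAB1.add (hΦ'.isBigO_sub_id x₀)
  have hAt : Tendsto (fun z : ℝ × EuclideanSpace ℝ (Fin d) => (z.1, Φ z.1 z.2)) (𝓝 (0, x₀))
      (𝓝 (0, x₀)) := hfst.prodMk_nhds hA
  have hBt : Tendsto (fun z : ℝ × EuclideanSpace ℝ (Fin d) => (z.1, Φ' z.1 z.2)) (𝓝 (0, x₀))
      (𝓝 (0, x₀)) := hfst.prodMk_nhds hB
  obtain ⟨χ, hχ, hχ0⟩ := hΨ'
  set Q := fun z : ℝ × EuclideanSpace ℝ (Fin d) =>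
    ∑ k ∈ Finset.range m, z.1 ^ k • (χ (k + 1)).1 z.2 with hQdef
  have hQ : ContDiff ℝ ∞ Q := SmoothMap.contDiff_sum_pow_smul (fun k => χ (k + 1)) _
  have hG : ∀ (h : ℝ) (x : EuclideanSpace ℝ (Fin d)),
      ∑ k ∈ Finset.range (m + 1), h ^ k • (χ k).1 x = h • Q (h, x) + x := by
    intro h x
    rw [Finset.sum_range_succ', hχ0, hQdef, Finset.smul_sum]
    simp [pow_succ', smul_smul, SmoothMap.identity]
  have t1 := (hΨ x₀).comp_tendsto hAt
  have t2 : (fun z : ℝ × EuclideanSpace ℝ (Fin d) => z.1 ^ m • (e'.1 (Φ z.1 z.2) - e'.1 z.2))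
      =O[𝓝 (0, x₀)] fun z => z.1 ^ (m + 1) := by
    have h1 := ((SmoothMap.contDiff_coe e').isBigO_sub_of_tendsto hA (continuous_snd.tendsto ((0 : ℝ), x₀))).trans hAx
    simpa only [smul_eq_mul, ← pow_succ] using
      (isBigO_refl (fun z : ℝ × EuclideanSpace ℝ (Fin d) => z.1 ^ m) (𝓝 (0, x₀))).smul h1
  have t3 := (hχ (m + 1) x₀).comp_tendsto hAt
  have t4 := (hχ (m + 1) x₀).comp_tendsto hBt
  have t5 : (fun z : ℝ × EuclideanSpace ℝ (Fin d) =>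
      z.1 • (Q (z.1, Φ z.1 z.2) - Q (z.1, Φ' z.1 z.2))) =O[𝓝 (0, x₀)] fun z => z.1 ^ (m + 1) := by
    have h1 : (fun z : ℝ × EuclideanSpace ℝ (Fin d) => Q (z.1, Φ z.1 z.2) - Q (z.1, Φ' z.1 z.2))
        =O[𝓝 (0, x₀)] fun z => z.1 ^ m := by
      refine (hQ.isBigO_sub_of_tendsto hAt hBt).trans (IsBigO.trans ?_ hAB)
      refine IsBigO.of_bound 1 (Eventually.of_forall fun z => ?_)
      simp [Prod.norm_def]
    simpa only [smul_eq_mul, ← pow_succ'] using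
      (isBigO_refl (fun z : ℝ × EuclideanSpace ℝ (Fin d) => z.1) (𝓝 (0, x₀))).smul h1
  refine (((((t1.add t2).add t3).sub t4).add t5).add (hΦ x₀)).congr_left fun z => ?_
  simp only [Function.comp_apply, hG]
  change _ = _ - z.1 ^ m • (e.1 z.2 + e'.1 z.2)
  rw [smul_add, smul_sub, smul_sub]
  abel

theorem twoSplit_zero (a b : Fin 0 → ℝ)
    (Φ Ψ : ℝ → EuclideanSpace ℝ (Fin d) → EuclideanSpace ℝ (Fin d)) :
    twoSplit a b Φ Ψ = fun _ x => x := by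
  funext h x
  simp [twoSplit]

theorem twoSplit_succ {s : ℕ} (a b : Fin (s + 1) → ℝ)
    (Φ Ψ : ℝ → EuclideanSpace ℝ (Fin d) → EuclideanSpace ℝ (Fin d)) :
    twoSplit a b Φ Ψ = fun h x => Ψ (b (Fin.last s) * h) (Φ (a (Fin.last s) * h)
      (twoSplit (fun j => a j.castSucc) (fun j => b j.castSucc) Φ Ψ h x)) := by
  funext h x
  simp [twoSplit, Fin.foldl_succ_last]

theorem IsSmoothStep.twoSplit (hΦ : IsSmoothStep Φ) (hΨ : IsSmoothStep Ψ) {s : ℕ}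
    (a b : Fin s → ℝ) : IsSmoothStep (twoSplit a b Φ Ψ) := by
  induction s with
  | zero => rw [twoSplit_zero]; exact isSmoothStep_id
  | succ s ih =>
    rw [twoSplit_succ]
    exact (hΨ.comp_mul_left _).comp ((hΦ.comp_mul_left _).comp (ih _ _))

theorem DiffersBy.twoSplit {m : ℕ} (hm : 1 ≤ m) {e e' : SmoothMap d} (hΦ : DiffersBy Φ Φ' m e)
    (hΨ : DiffersBy Ψ Ψ' m e') (hΦ' : IsSmoothStep Φ') (hΨ' : IsSmoothStep Ψ') {s : ℕ}
    (a b : Fin s → ℝ) :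
    DiffersBy (twoSplit a b Φ Ψ) (twoSplit a b Φ' Ψ') m
      ((∑ j, a j ^ m) • e + (∑ j, b j ^ m) • e') := by
  induction s with
  | zero =>
    rw [twoSplit_zero, twoSplit_zero]
    simpa using differsBy_self (d := d) (fun _ x => x) m
  | succ s ih =>
    rw [twoSplit_succ, twoSplit_succ]
    have key := (hΨ.comp_mul_left (b (Fin.last s))).comp hm
      ((hΦ.comp_mul_left (a (Fin.last s))).comp hm
        (ih (fun j => a j.castSucc) fun j => b j.castSucc)
        (hΦ'.comp_mul_left _) (hΦ'.twoSplit hΨ' _ _))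
      (hΨ'.comp_mul_left _) ((hΦ'.comp_mul_left _).comp (hΦ'.twoSplit hΨ' _ _))
    convert key using 1
    rw [Fin.sum_univ_castSucc, Fin.sum_univ_castSucc, add_smul, add_smul]
    abel

end Expansions

/-! ### Leading error relative to the exact flow -/

section LeadingError

variable {d : ℕ} {Φ Φ' : ℝ → EuclideanSpace ℝ (Fin d) → EuclideanSpace ℝ (Fin d)}
  {g e e' : SmoothMap d} {p : ℕ}

theorem hasExpExpansion_exactFlow (hp : 1 ≤ p) (g : SmoothMap d) :
    HasExpExpansion (exactFlow g) g p 0 :=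
  (hasExpansion_exactFlow g).hasExpExpansion hp (fun _ _ => rfl) (add_zero _).symm

theorem HasExpExpansion.isSmoothStep (hp : 1 ≤ p) (h : HasExpExpansion Φ g p e) :
    IsSmoothStep Φ := by
  obtain ⟨ψ, hψ, hlow, -⟩ := h.exists_hasExpansion hp
  exact ⟨ψ, hψ, by rw [hlow 0 (Nat.zero_le p), flowCoeff_zero]⟩

theorem HasExpExpansion.differsBy_exactFlow (hp : 1 ≤ p) (h : HasExpExpansion Φ g p e) :
    DiffersBy Φ (exactFlow g) (p + 1) e := by
  obtain ⟨ψ, hψ, hlow, hlead⟩ := h.exists_hasExpansion hp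
  exact hψ.differsBy (hasExpansion_exactFlow g) (fun k hk => hlow k (Nat.lt_succ_iff.1 hk)) hlead

/-- `DiffersBy` fixes the coefficients through degree `p + 1` only; `IsSmoothStep` supplies the
higher ones that the exponential form requires. -/
theorem HasExpExpansion.add_of_differsBy (hp : 1 ≤ p) (h' : HasExpExpansion Φ' g p e')
    (hΦ : IsSmoothStep Φ) (h : DiffersBy Φ Φ' (p + 1) e) : HasExpExpansion Φ g p (e' + e) := by
  obtain ⟨χ, hχ, hlow, hlead⟩ := h'.exists_hasExpansion hp
  obtain ⟨ψ, hψ, -⟩ := hΦ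
  obtain ⟨h1, h2⟩ := h.coeff_eq hψ hχ
  exact hψ.hasExpExpansion hp (fun k hk => (h1 k (Nat.lt_succ_iff.2 hk)).trans (hlow k hk))
    (by rw [h2, hlead, add_assoc])

/-- Brings all nodes to the common order `p`; those of higher order then contribute zero, which
produces the filter `ord v = p` in the final sum. -/
theorem HasExpExpansion.of_le {q : ℕ} (hp : 1 ≤ p) (hpq : p ≤ q) (h : HasExpExpansion Φ g q e) :
    HasExpExpansion Φ g p (if q = p then e else 0) := by
  split_ifs with hqp
  · exact hqp ▸ h
  · obtain ⟨ψ, hψ, hlow, -⟩ := h.exists_hasExpansion (hp.trans hpq)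
    exact hψ.hasExpExpansion hp (fun k hk => hlow k (hk.trans hpq))
      (by rw [hlow _ (by omega), add_zero])

end LeadingError

/-! ### Combinatorics of splitting trees -/

namespace LeafTree

variable {N : ℕ} {l r t : LeafTree N} {v w : Finset (Fin N)}

theorem label_nonempty (t : LeafTree N) : t.label.Nonempty := by
  induction t with
  | leaf m => exact Finset.singleton_nonempty m
  | node l r hl _ => exact hl.mono Finset.subset_union_left

/-- All nodes, identified with their labels. -/
def nodes (t : LeafTree N) : Finset (Finset (Fin N)) := t.innerNodes ∪ t.leafNodes

theorem mem_nodes_node :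
    v ∈ (node l r).nodes ↔ v = l.label ∪ r.label ∨ v ∈ l.nodes ∨ v ∈ r.nodes := by
  simp only [nodes, innerNodes, leafNodes, Finset.mem_union, Finset.mem_insert]
  tauto

theorem innerNodes_subset_nodes (t : LeafTree N) : t.innerNodes ⊆ t.nodes :=
  Finset.subset_union_left

theorem subset_label_of_mem_nodes (h : v ∈ t.nodes) : v ⊆ t.label := by
  induction t with
  | leaf m =>
    simp only [nodes, innerNodes, leafNodes, Finset.empty_union, Finset.mem_singleton] at h
    exact h.subset
  | node l r hl hr =>
    rcases mem_nodes_node.1 h with rfl | h | h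
    · exact subset_rfl
    · exact (hl h).trans Finset.subset_union_left
    · exact (hr h).trans Finset.subset_union_right

theorem nonempty_of_mem_nodes (h : v ∈ t.nodes) : v.Nonempty := by
  induction t with
  | leaf m =>
    simp only [nodes, innerNodes, leafNodes, Finset.empty_union, Finset.mem_singleton] at h
    exact h ▸ Finset.singleton_nonempty m
  | node l r hl hr =>
    rcases mem_nodes_node.1 h with rfl | h | h
    · exact (node l r).label_nonempty
    · exact hl h
    · exact hr h

/-- Nodes are non-empty subsets of the label of their tree. This makes identifying a node with its
subset unambiguous, so lookups descend into the correct subtree. -/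
theorem disjoint_nodes (hd : Disjoint l.label r.label) : Disjoint l.nodes r.nodes := by
  rw [Finset.disjoint_left]
  intro v hl hr
  obtain ⟨m, hm⟩ := nonempty_of_mem_nodes hl
  exact Finset.disjoint_left.1 hd (subset_label_of_mem_nodes hl hm) (subset_label_of_mem_nodes hr hm)

theorem ne_union_of_subset_left (hd : Disjoint l.label r.label) (h : v ⊆ l.label) :
    v ≠ l.label ∪ r.label := by
  rintro rfl
  obtain ⟨m, hm⟩ := r.label_nonempty
  exact Finset.disjoint_left.1 hd (h (Finset.mem_union_right _ hm)) hm

theorem ne_union_of_subset_right (hd : Disjoint l.label r.label) (h : v ⊆ r.label) :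
    v ≠ l.label ∪ r.label := by
  rw [Finset.union_comm]
  exact ne_union_of_subset_left hd.symm h

theorem card_eq_one_of_mem_leafNodes (h : v ∈ t.leafNodes) : v.card = 1 := by
  induction t with
  | leaf m =>
    rw [leafNodes, Finset.mem_singleton] at h
    rw [h, Finset.card_singleton]
  | node l r hl hr =>
    rw [leafNodes, Finset.mem_union] at h
    exact h.elim hl hr

theorem one_lt_card_of_mem_innerNodes (ht : t.DisjointChildren) (h : v ∈ t.innerNodes) :
    1 < v.card := by
  induction t with
  | leaf m => simp [innerNodes] at h
  | node l r hl hr =>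
    rw [innerNodes, Finset.mem_insert, Finset.mem_union] at h
    obtain ⟨hd, hdl, hdr⟩ := ht
    rcases h with rfl | h | h
    · rw [Finset.card_union_of_disjoint hd]
      have := l.label_nonempty.card_pos
      have := r.label_nonempty.card_pos
      omega
    · exact hl hdl h
    · exact hr hdr h

/-- Cardinality separates them. Consequently the case distinction in `nodeMethod` gives numerical
leaves their scheme. -/
theorem disjoint_innerNodes_leafNodes (ht : t.DisjointChildren) :
    Disjoint t.innerNodes t.leafNodes := by
  rw [Finset.disjoint_left]
  intro v h1 h2
  exact (one_lt_card_of_mem_innerNodes ht h1).ne' (card_eq_one_of_mem_leafNodes h2)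

theorem leftChild_union : (node l r).leftChild (l.label ∪ r.label) = l.label := by
  simp [leftChild]

theorem rightChild_union : (node l r).rightChild (l.label ∪ r.label) = r.label := by
  simp [rightChild]

theorem leftChild_node_of_mem_left (hd : Disjoint l.label r.label) (h : w ∈ l.innerNodes) :
    (node l r).leftChild w = l.leftChild w := by
  rw [leftChild, if_neg (ne_union_of_subset_left hd
    (subset_label_of_mem_nodes (innerNodes_subset_nodes l h))), if_pos h]

theorem rightChild_node_of_mem_left (hd : Disjoint l.label r.label) (h : w ∈ l.innerNodes) :
    (node l r).rightChild w = l.rightChild w := by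
  rw [rightChild, if_neg (ne_union_of_subset_left hd
    (subset_label_of_mem_nodes (innerNodes_subset_nodes l h))), if_pos h]

theorem leftChild_node_of_mem_right (hd : Disjoint l.label r.label) (h : w ∈ r.innerNodes) :
    (node l r).leftChild w = r.leftChild w := by
  have hr := innerNodes_subset_nodes r h
  rw [leftChild, if_neg (ne_union_of_subset_right hd (subset_label_of_mem_nodes hr)), if_neg]
  exact fun hl => Finset.disjoint_left.1 (disjoint_nodes hd) (innerNodes_subset_nodes l hl) hr

theorem rightChild_node_of_mem_right (hd : Disjoint l.label r.label) (h : w ∈ r.innerNodes) :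
    (node l r).rightChild w = r.rightChild w := by
  have hr := innerNodes_subset_nodes r h
  rw [rightChild, if_neg (ne_union_of_subset_right hd (subset_label_of_mem_nodes hr)), if_neg]
  exact fun hl => Finset.disjoint_left.1 (disjoint_nodes hd) (innerNodes_subset_nodes l hl) hr

theorem leftChild_subset (t : LeafTree N) (w : Finset (Fin N)) : t.leftChild w ⊆ t.label := by
  induction t with
  | leaf m => exact Finset.empty_subset _
  | node l r hl hr =>
    rw [leftChild, label]
    split_ifs
    · exact Finset.subset_union_left
    · exact hl.trans Finset.subset_union_left
    · exact hr.trans Finset.subset_union_right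

theorem path_union : (node l r).path (l.label ∪ r.label) = ∅ := by
  simp [path]

theorem path_node_of_mem_left (hd : Disjoint l.label r.label) (h : v ∈ l.nodes) :
    (node l r).path v = insert (l.label ∪ r.label) (l.path v) := by
  rw [path, if_neg (ne_union_of_subset_left hd (subset_label_of_mem_nodes h)),
    if_pos (c := v ∈ l.innerNodes ∪ l.leafNodes) h]

theorem path_node_of_mem_right (hd : Disjoint l.label r.label) (h : v ∈ r.nodes) :
    (node l r).path v = insert (l.label ∪ r.label) (r.path v) := by
  rw [path, if_neg (ne_union_of_subset_right hd (subset_label_of_mem_nodes h)), if_neg]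
  exact fun hl => Finset.disjoint_left.1 (disjoint_nodes hd) hl h

theorem path_subset (t : LeafTree N) (v : Finset (Fin N)) : t.path v ⊆ t.innerNodes := by
  induction t with
  | leaf m => exact Finset.empty_subset _
  | node l r hl hr =>
    rw [path, innerNodes]
    split_ifs
    · exact Finset.empty_subset _
    · exact Finset.insert_subset_insert _ (hl.trans Finset.subset_union_left)
    · exact Finset.insert_subset_insert _ (hr.trans Finset.subset_union_right)

theorem label_mem_insert_path (h : v ∈ t.nodes) : t.label ∈ insert v (t.path v) := by
  cases t with
  | leaf m =>
    simp only [nodes, innerNodes, leafNodes, Finset.empty_union, Finset.mem_singleton] at h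
    simp [h, label]
  | node l r =>
    rw [path, label]
    split_ifs with hv <;> simp [hv]

theorem insert_path_subset_nodes (h : v ∈ t.nodes) : insert v (t.path v) ⊆ t.nodes :=
  Finset.insert_subset h ((path_subset t v).trans t.innerNodes_subset_nodes)

/-- The left child of the root is the label of `l`, where the remaining path starts. -/
theorem branch_union_of_mem_left (hd : Disjoint l.label r.label) (h : v ∈ l.nodes) :
    (node l r).branch v (l.label ∪ r.label) = 1 := by
  rw [branch, leftChild_union, path_node_of_mem_left hd h, if_pos]
  rw [Finset.insert_comm]
  exact Finset.mem_insert_of_mem (label_mem_insert_path h)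

theorem branch_union_of_mem_right (hd : Disjoint l.label r.label) (h : v ∈ r.nodes) :
    (node l r).branch v (l.label ∪ r.label) = 0 := by
  rw [branch, leftChild_union, path_node_of_mem_right hd h, if_neg]
  rw [Finset.insert_comm, Finset.mem_insert, not_or]
  refine ⟨ne_union_of_subset_left hd subset_rfl, fun hl => ?_⟩
  obtain ⟨m, hm⟩ := l.label_nonempty
  exact Finset.disjoint_left.1 hd hm
    (subset_label_of_mem_nodes (insert_path_subset_nodes h hl) hm)

/-- The path in the larger tree gains only the root label, which is too large to be a left child
inside `l`; the membership test is unchanged. -/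
theorem branch_node_of_mem_left (hd : Disjoint l.label r.label) (h : v ∈ l.nodes)
    (hw : w ∈ l.path v) : (node l r).branch v w = l.branch v w := by
  have : l.leftChild w ≠ l.label ∪ r.label := ne_union_of_subset_left hd (l.leftChild_subset w)
  rw [branch, branch, leftChild_node_of_mem_left hd (path_subset l v hw),
    path_node_of_mem_left hd h, Finset.insert_comm]
  simp only [Finset.mem_insert, this, false_or]

theorem branch_node_of_mem_right (hd : Disjoint l.label r.label) (h : v ∈ r.nodes)
    (hw : w ∈ r.path v) : (node l r).branch v w = r.branch v w := by
  have : r.leftChild w ≠ l.label ∪ r.label := ne_union_of_subset_right hd (r.leftChild_subset w)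
  rw [branch, branch, leftChild_node_of_mem_right hd (path_subset r v hw),
    path_node_of_mem_right hd h, Finset.insert_comm]
  simp only [Finset.mem_insert, this, false_or]

end LeafTree

/-! ### Error weights and induction over the tree -/

namespace HierarchicalSplitting

variable {N d : ℕ} {l r t : LeafTree N} {v : Finset (Fin N)}

/-- The factor of the error of the node `v` of a tree in the error of the root. -/
noncomputable def pathWeight (H : HierarchicalSplitting N d) (p : ℕ) (t : LeafTree N)
    (v : Finset (Fin N)) : ℝ :=
  ∏ w ∈ t.path v, ∑ j : Fin (H.stages w),
    (t.branch v w * H.a w j + (1 - t.branch v w) * H.b w j) ^ (p + 1)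

theorem pathWeight_leaf (H : HierarchicalSplitting N d) (p : ℕ) (m : Fin N) :
    H.pathWeight p (.leaf m) v = 1 := by
  rw [pathWeight, LeafTree.path, Finset.prod_empty]

theorem pathWeight_union (H : HierarchicalSplitting N d) (p : ℕ) :
    H.pathWeight p (.node l r) (l.label ∪ r.label) = 1 := by
  rw [pathWeight, LeafTree.path_union, Finset.prod_empty]

theorem pathWeight_of_mem_left (H : HierarchicalSplitting N d) (p : ℕ)
    (hd : Disjoint l.label r.label) (h : v ∈ l.nodes) :
    H.pathWeight p (.node l r) v
      = (∑ j, H.a (l.label ∪ r.label) j ^ (p + 1)) * H.pathWeight p l v := by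
  rw [pathWeight, LeafTree.path_node_of_mem_left hd h, Finset.prod_insert fun h' =>
    LeafTree.ne_union_of_subset_left hd (LeafTree.subset_label_of_mem_nodes
      (l.innerNodes_subset_nodes (l.path_subset v h'))) rfl,
    LeafTree.branch_union_of_mem_left hd h]
  congr 1
  · simp
  · exact Finset.prod_congr rfl fun w hw => by rw [LeafTree.branch_node_of_mem_left hd h hw]

theorem pathWeight_of_mem_right (H : HierarchicalSplitting N d) (p : ℕ)
    (hd : Disjoint l.label r.label) (h : v ∈ r.nodes) :
    H.pathWeight p (.node l r) v
      = (∑ j, H.b (l.label ∪ r.label) j ^ (p + 1)) * H.pathWeight p r v := by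
  rw [pathWeight, LeafTree.path_node_of_mem_right hd h, Finset.prod_insert fun h' =>
    LeafTree.ne_union_of_subset_right hd (LeafTree.subset_label_of_mem_nodes
      (r.innerNodes_subset_nodes (r.path_subset v h'))) rfl,
    LeafTree.branch_union_of_mem_right hd h]
  congr 1
  · simp
  · exact Finset.prod_congr rfl fun w hw => by rw [LeafTree.branch_node_of_mem_right hd h hw]

/-- The nodes of a subtree to which an approximate method is assigned. -/
def subtreeMethodNodes (H : HierarchicalSplitting N d) (t : LeafTree N) : Finset (Finset (Fin N)) :=
  t.innerNodes ∪ (H.numericalLeaves ∩ t.leafNodes)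

theorem subtreeMethodNodes_subset (H : HierarchicalSplitting N d) (t : LeafTree N) :
    H.subtreeMethodNodes t ⊆ t.nodes :=
  Finset.union_subset_union_right Finset.inter_subset_right

theorem subtreeMethodNodes_node (H : HierarchicalSplitting N d) (l r : LeafTree N) :
    H.subtreeMethodNodes (.node l r)
      = insert (l.label ∪ r.label) (H.subtreeMethodNodes l ∪ H.subtreeMethodNodes r) := by
  ext v
  simp only [subtreeMethodNodes, LeafTree.innerNodes, LeafTree.leafNodes, Finset.mem_union,
    Finset.mem_insert, Finset.mem_inter]
  tauto

/-- Root, left nodes and right nodes are disjoint, and peeling the root off each path extracts its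
`a`- or `b`-sum. The result has the shape produced by `DiffersBy.twoSplit`. -/
theorem sum_subtreeMethodNodes_node (H : HierarchicalSplitting N d) (p : ℕ)
    (ord : Finset (Fin N) → ℕ) (err : Finset (Fin N) → SmoothMap d)
    (hd : Disjoint l.label r.label) :
    ∑ v ∈ H.subtreeMethodNodes (.node l r) with ord v = p, H.pathWeight p (.node l r) v • err v
      = (if ord (l.label ∪ r.label) = p then err (l.label ∪ r.label) else 0)
        + ((∑ j, H.a (l.label ∪ r.label) j ^ (p + 1)) •
            ∑ v ∈ H.subtreeMethodNodes l with ord v = p, H.pathWeight p l v • err v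
          + (∑ j, H.b (l.label ∪ r.label) j ^ (p + 1)) •
            ∑ v ∈ H.subtreeMethodNodes r with ord v = p, H.pathWeight p r v • err v) := by
  have hl := H.subtreeMethodNodes_subset l
  have hr := H.subtreeMethodNodes_subset r
  simp only [Finset.sum_filter]
  rw [subtreeMethodNodes_node, Finset.sum_insert, Finset.sum_union, pathWeight_union, one_smul,
    Finset.smul_sum, Finset.smul_sum]
  · congr 2
    · refine Finset.sum_congr rfl fun v hv => ?_
      rw [pathWeight_of_mem_left H p hd (hl hv), smul_ite, smul_zero, smul_smul]
    · refine Finset.sum_congr rfl fun v hv => ?_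
      rw [pathWeight_of_mem_right H p hd (hr hv), smul_ite, smul_zero, smul_smul]
  · exact Finset.disjoint_of_subset_left hl
      (Finset.disjoint_of_subset_right hr (LeafTree.disjoint_nodes hd))
  · rw [Finset.mem_union, not_or]
    exact ⟨fun h => LeafTree.ne_union_of_subset_left hd
      (LeafTree.subset_label_of_mem_nodes (hl h)) rfl,
      fun h => LeafTree.ne_union_of_subset_right hd
      (LeafTree.subset_label_of_mem_nodes (hr h)) rfl⟩

/-- The leading error of the recursive step on a subtree. -/
theorem hasExpExpansion_step (H : HierarchicalSplitting N d) (f : Fin N → SmoothMap d)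
    (ord : Finset (Fin N) → ℕ) (err : Finset (Fin N) → SmoothMap d) {p : ℕ} (hp : 1 ≤ p)
    (ht : t.DisjointChildren)
    (hord : ∀ v ∈ H.subtreeMethodNodes t, p ≤ ord v)
    (hinner : ∀ v ∈ t.innerNodes, HasExpExpansion
      (twoSplit (H.a v) (H.b v) (exactFlow (∑ m ∈ t.leftChild v, f m))
        (exactFlow (∑ m ∈ t.rightChild v, f m))) (∑ m ∈ v, f m) (ord v) (err v))
    (hleaf : ∀ v ∈ H.numericalLeaves, v ∈ t.leafNodes →
      HasExpExpansion (H.scheme v) (∑ m ∈ v, f m) (ord v) (err v)) :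
    HasExpExpansion (H.step f t) (∑ m ∈ t.label, f m) p
      (∑ v ∈ H.subtreeMethodNodes t with ord v = p, H.pathWeight p t v • err v) := by
  induction t with
  | leaf m =>
    rw [step, LeafTree.label]
    split_ifs with hm
    · have hnodes : H.subtreeMethodNodes (.leaf m) = {{m}} := by
        simp [subtreeMethodNodes, LeafTree.innerNodes, LeafTree.leafNodes, hm]
      rw [hnodes] at hord ⊢
      have := (hleaf {m} hm (by simp [LeafTree.leafNodes])).of_le hp
        (hord _ (Finset.mem_singleton_self _))
      simpa [Finset.sum_filter, pathWeight_leaf] using this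
    · have hnodes : H.subtreeMethodNodes (.leaf m) = ∅ := by
        simp [subtreeMethodNodes, LeafTree.innerNodes, LeafTree.leafNodes, hm]
      rw [hnodes, Finset.sum_singleton, Finset.filter_empty, Finset.sum_empty]
      exact hasExpExpansion_exactFlow hp (f m)
  | node l r ihl ihr =>
    obtain ⟨hd, hdl, hdr⟩ := ht
    have hl := ihl hdl
      (fun v hv => hord v (by
        rw [subtreeMethodNodes_node]
        exact Finset.mem_insert_of_mem (Finset.mem_union_left _ hv)))
      (fun v hv => by
        have := hinner v (Finset.mem_insert_of_mem (Finset.mem_union_left _ hv))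
        rwa [LeafTree.leftChild_node_of_mem_left hd hv,
          LeafTree.rightChild_node_of_mem_left hd hv] at this)
      (fun v hv hvl => hleaf v hv (Finset.mem_union_left _ hvl))
    have hr := ihr hdr
      (fun v hv => hord v (by
        rw [subtreeMethodNodes_node]
        exact Finset.mem_insert_of_mem (Finset.mem_union_right _ hv)))
      (fun v hv => by
        have := hinner v (Finset.mem_insert_of_mem (Finset.mem_union_right _ hv))
        rwa [LeafTree.leftChild_node_of_mem_right hd hv,
          LeafTree.rightChild_node_of_mem_right hd hv] at this)
      (fun v hv hvr => hleaf v hv (Finset.mem_union_right _ hvr))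
    have hroot := hinner (l.label ∪ r.label) (Finset.mem_insert_self _ _)
    rw [LeafTree.leftChild_union, LeafTree.rightChild_union] at hroot
    have hroot' := hroot.of_le hp (hord _ (by
      rw [subtreeMethodNodes_node]
      exact Finset.mem_insert_self _ _))
    rw [sum_subtreeMethodNodes_node H p ord err hd]
    -- The reference map is the node's splitting with exact child flows, whose own error is
    -- `hroot'`; passing to the recursive child steps adds the two propagated errors.
    exact hroot'.add_of_differsBy hp
      ((hl.isSmoothStep hp).twoSplit (hr.isSmoothStep hp) _ _)
      ((hl.differsBy_exactFlow hp).twoSplit (by omega) (hr.differsBy_exactFlow hp)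
        (isSmoothStep_exactFlow _) (isSmoothStep_exactFlow _) _ _)

theorem subtreeMethodNodes_tree (H : HierarchicalSplitting N d) :
    H.subtreeMethodNodes H.tree = H.methodNodes := by
  rw [subtreeMethodNodes, methodNodes, Finset.inter_eq_left.2 H.numericalLeaves_subset]

theorem hasExpExpansion_method (H : HierarchicalSplitting N d) (f : Fin N → SmoothMap d)
    (ord : Finset (Fin N) → ℕ) (err : Finset (Fin N) → SmoothMap d) {p : ℕ} (hp : 1 ≤ p)
    (hord : ∀ v ∈ H.methodNodes, p ≤ ord v)
    (hexp : ∀ v ∈ H.methodNodes,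
      HasExpExpansion (H.nodeMethod f v) (∑ m ∈ v, f m) (ord v) (err v)) :
    HasExpExpansion (H.method f) (∑ m, f m) p
      (∑ v ∈ H.methodNodes with ord v = p, H.errorWeight p v • err v) := by
  have hdisj := H.isSplittingTree.2
  have key := H.hasExpExpansion_step f ord err hp hdisj
    (by rwa [subtreeMethodNodes_tree])
    (fun v hv => by
      have := hexp v (Finset.mem_union_left _ hv)
      rwa [nodeMethod, if_pos hv] at this)
    (fun v hv hvl => by
      have := hexp v (Finset.mem_union_right _ hv)
      rwa [nodeMethod, if_neg fun h => Finset.disjoint_left.1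
        (LeafTree.disjoint_innerNodes_leafNodes hdisj) h hvl] at this)
  rwa [subtreeMethodNodes_tree, H.isSplittingTree.1] at key

end HierarchicalSplitting

/-! ### Convergence of one-step methods -/

section Convergence

variable {d : ℕ} {Φ : ℝ → EuclideanSpace ℝ (Fin d) → EuclideanSpace ℝ (Fin d)}
  {g e : SmoothMap d} {p : ℕ} {ψ : ℕ → SmoothMap d}

/-- One step of the method near a compact set, compared with its truncated expansion. -/
theorem HasExpansion.exists_norm_sub_le (h : HasExpansion Φ ψ) (h0 : ψ 0 = SmoothMap.identity d)
    {K : Set (EuclideanSpace ℝ (Fin d))} (hK : IsCompact K) (n : ℕ) :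
    ∃ C : ℝ, 0 ≤ C ∧ ∃ δ > 0, ∀ x ∈ K, ∀ (t : ℝ) (y : EuclideanSpace ℝ (Fin d)),
      |t| < δ → ‖y - x‖ < δ →
      ‖Φ t y - ∑ k ∈ Finset.range (n + 1), t ^ k • (ψ k).1 x‖
        ≤ (1 + C * |t|) * ‖y - x‖ + C * |t| ^ (n + 1) := by
  -- The estimate passes to subsets and finite unions, so by compactness it suffices near each
  -- point.
  refine hK.induction_on (p := fun S => ∃ C : ℝ, 0 ≤ C ∧ ∃ δ > 0, ∀ x ∈ S, ∀ (t : ℝ)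
      (y : EuclideanSpace ℝ (Fin d)), |t| < δ → ‖y - x‖ < δ →
      ‖Φ t y - ∑ k ∈ Finset.range (n + 1), t ^ k • (ψ k).1 x‖
        ≤ (1 + C * |t|) * ‖y - x‖ + C * |t| ^ (n + 1)) ?_ ?_ ?_ ?_
  · exact ⟨0, le_rfl, 1, one_pos, fun x hx => hx.elim⟩
  · rintro S S' hS ⟨C, hC, δ, hδ, H⟩
    exact ⟨C, hC, δ, hδ, fun x hx => H x (hS hx)⟩
  · rintro S S' ⟨C, hC, δ, hδ, H⟩ ⟨C', hC', δ', hδ', H'⟩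
    refine ⟨max C C', le_max_of_le_left hC, min δ δ', lt_min hδ hδ', fun x hx t y ht hy => ?_⟩
    rcases hx with hx | hx
    · refine (H x hx t y (ht.trans_le (min_le_left _ _)) (hy.trans_le (min_le_left _ _))).trans ?_
      gcongr <;> exact le_max_left _ _
    · refine (H' x hx t y (ht.trans_le (min_le_right _ _)) (hy.trans_le (min_le_right _ _))).trans ?_
      gcongr <;> exact le_max_right _ _
  · intro x₀ _
    -- The truncated expansion is `Id + t Q` with `Q` locally Lipschitz; this yields the stability
    -- factor `1 + C |t|` although `Φ` itself need not be Lipschitz.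
    set Q := fun z : ℝ × EuclideanSpace ℝ (Fin d) =>
      ∑ k ∈ Finset.range n, z.1 ^ k • (ψ (k + 1)).1 z.2 with hQdef
    have hQ : ContDiff ℝ ∞ Q := SmoothMap.contDiff_sum_pow_smul (fun k => ψ (k + 1)) _
    have hG : ∀ (t : ℝ) (x : EuclideanSpace ℝ (Fin d)),
        ∑ k ∈ Finset.range (n + 1), t ^ k • (ψ k).1 x = t • Q (t, x) + x := by
      intro t x
      rw [Finset.sum_range_succ', h0, hQdef, Finset.smul_sum]
      simp [pow_succ', smul_smul, SmoothMap.identity]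
    obtain ⟨L, s, hs, hL⟩ :=
      ((hQ.contDiffAt (x := (0, x₀))).of_le (m := 1) (by simp)).exists_lipschitzOnWith
    obtain ⟨C, hC⟩ := (h (n + 1) x₀).bound
    obtain ⟨ε, hε, hball⟩ := Metric.mem_nhds_iff.1 (inter_mem hs hC)
    refine ⟨Metric.ball x₀ (ε / 2), mem_nhdsWithin_of_mem_nhds
      (Metric.ball_mem_nhds x₀ (half_pos hε)), max L C, le_max_of_le_left L.2, ε / 2, half_pos hε,
      fun x hx t y ht hy => ?_⟩
    have hx' : (t, x) ∈ Metric.ball ((0 : ℝ), x₀) ε := by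
      rw [mem_ball_iff_norm] at hx ⊢
      rw [Prod.norm_def]
      refine max_lt ?_ ?_
      · simpa using ht.trans (half_lt_self hε)
      · exact hx.trans (half_lt_self hε)
    have hy' : (t, y) ∈ Metric.ball ((0 : ℝ), x₀) ε := by
      rw [mem_ball_iff_norm] at hx ⊢
      rw [Prod.norm_def]
      refine max_lt ?_ ?_
      · simpa using ht.trans (half_lt_self hε)
      · calc ‖y - x₀‖ ≤ ‖y - x‖ + ‖x - x₀‖ := norm_sub_le_norm_sub_add_norm_sub _ _ _
          _ < ε := by linarith
    have h1 : ‖Q (t, y) - Q (t, x)‖ ≤ L * ‖y - x‖ := by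
      refine (hL.norm_sub_le (hball hy').1 (hball hx').1).trans_eq ?_
      simp [Prod.norm_def]
    have h2 : ‖Φ t y - (t • Q (t, y) + y)‖ ≤ C * |t| ^ (n + 1) := by
      have := (hball hy').2
      rw [Set.mem_ofPred_eq, hG, norm_pow, Real.norm_eq_abs] at this
      exact this
    rw [hG]
    calc ‖Φ t y - (t • Q (t, x) + x)‖
        = ‖(Φ t y - (t • Q (t, y) + y)) + (t • (Q (t, y) - Q (t, x)) + (y - x))‖ := by
          rw [smul_sub]
          congr 1
          abel
      _ ≤ C * |t| ^ (n + 1) + (|t| * (L * ‖y - x‖) + ‖y - x‖) := by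
          refine (norm_add_le _ _).trans (add_le_add h2 ((norm_add_le _ _).trans ?_))
          rw [norm_smul, Real.norm_eq_abs]
          gcongr
      _ = (1 + L * |t|) * ‖y - x‖ + C * |t| ^ (n + 1) := by ring
      _ ≤ _ := by
          gcongr
          · exact le_max_left _ _
          · exact le_max_right _ _

/-- At each grid point the numerical step and the exact solution are compared with the same
truncated expansion; the error recursion is then solved by discrete Gronwall. -/
theorem HasExpExpansion.convergesWithOrder (hp : 1 ≤ p) (hΦ : HasExpExpansion Φ g p e) :
    ConvergesWithOrder Φ g p := by
  intro T x hx
  obtain ⟨ψ, hψ, hlow, -⟩ := hΦ.exists_hasExpansion hp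
  have h0 : ψ 0 = SmoothMap.identity d := by rw [hlow 0 (Nat.zero_le p), flowCoeff_zero]
  have hK : IsCompact (x '' Set.Icc 0 T) := isCompact_Icc.image_of_continuousOn hx.continuousOn
  obtain ⟨L, hL, δ, hδ, hstep⟩ := hψ.exists_norm_sub_le h0 hK p
  obtain ⟨D, hD, htaylor⟩ := exists_norm_sub_sum_taylor_le (SmoothMap.contDiff_coe g) hK (p + 1)
    (contDiff_id (𝕜 := ℝ) (E := EuclideanSpace ℝ (Fin d)) (n := ∞))
  have hexact : ∀ t h : ℝ, 0 ≤ t → 0 ≤ h → t + h ≤ T →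
      ‖x (t + h) - ∑ k ∈ Finset.range (p + 1), h ^ k • (ψ k).1 (x t)‖ ≤ D * h ^ (p + 1) := by
    intro t h ht hh htT
    have hsub : ∀ s ∈ Set.Icc 0 h, t + s ∈ Set.Icc 0 T := fun s hs =>
      ⟨by linarith [hs.1], by linarith [hs.2]⟩
    have := htaylor h (fun s => x (t + s))
      (fun s hs => by
        rw [Set.uIcc_of_le hh] at hs ⊢
        have := (hx (t + s) (hsub s hs)).scomp s
          (((hasDerivAt_id s).const_add t).hasDerivWithinAt (s := Set.Icc 0 h)) hsub
        simpa [Function.comp_def] using this)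
      (fun s hs => by
        rw [Set.uIcc_of_le hh] at hs
        exact Set.mem_image_of_mem x (hsub s hs))
    rw [abs_of_nonneg hh, add_zero] at this
    refine le_trans (le_of_eq ?_) this
    congr 2
    refine Finset.sum_congr rfl fun k hk => ?_
    rw [hlow k (Nat.lt_succ_iff.1 (Finset.mem_range.1 hk)), coe_flowCoeff]
  set A := |T| * (L + D) * Real.exp (L * |T|) with hA
  have hA0 : 0 ≤ A := by positivity
  -- The bound 1 gives `h^p ≤ h`, `δ / 2` gives `h < δ`, and the last term gives `A h < δ`, which
  -- keeps the numerical solution where `hstep` applies.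
  refine ⟨A, min 1 (min (δ / 2) (δ / (2 * (A + 1)))), by positivity, fun h hh hle n hn => ?_⟩
  have hh1 : h ≤ 1 := hle.trans (min_le_left _ _)
  have hhδ : h < δ := (hle.trans ((min_le_right _ _).trans (min_le_left _ _))).trans_lt
    (half_lt_self hδ)
  have hhA : A * h < δ := by
    have h1 : h ≤ δ / (2 * (A + 1)) := hle.trans ((min_le_right _ _).trans (min_le_right _ _))
    rw [le_div_iff₀ (by positivity)] at h1
    nlinarith
  have hbound : ∀ n : ℕ, (n : ℝ) * h ≤ T →
      n * h * (L + D) * Real.exp (L * (n * h)) * h ^ p ≤ A * h ^ p := by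
    intro n hn
    have : (n : ℝ) * h ≤ |T| := hn.trans (le_abs_self T)
    rw [hA]
    gcongr
  have main : ∀ n : ℕ, (n : ℝ) * h ≤ T →
      ‖(Φ h)^[n] (x 0) - x (n * h)‖ ≤ n * h * (L + D) * Real.exp (L * (n * h)) * h ^ p := by
    intro n
    induction n with
    | zero => simp
    | succ n ih =>
      intro hn
      have hn' : (n : ℝ) * h + h ≤ T := by
        push_cast at hn
        linarith
      have hnT : (n : ℝ) * h ≤ T := by linarith
      have hn0 : 0 ≤ (n : ℝ) * h := by positivity
      have ihn := ih hnT
      -- Bootstrap: the error bound at step `n` itself guarantees the closeness needed for the next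
      -- step.
      have hclose : ‖(Φ h)^[n] (x 0) - x (n * h)‖ < δ := by
        refine (ihn.trans (hbound n hnT)).trans_lt (lt_of_le_of_lt ?_ hhA)
        gcongr
        exact (pow_le_pow_of_le_one hh.le hh1 hp).trans_eq (pow_one h)
      have h1 := hstep (x (n * h)) (Set.mem_image_of_mem x ⟨hn0, hnT⟩) h _
        (by rwa [abs_of_pos hh]) hclose
      have h2 := hexact (n * h) h hn0 hh.le hn'
      rw [abs_of_pos hh] at h1
      have hcast : ((n + 1 : ℕ) : ℝ) * h = n * h + h := by
        push_cast
        ring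
      rw [Function.iterate_succ_apply', hcast]
      set E := Real.exp (L * (n * h)) with hE
      -- From `1 + L h ≤ exp (L h)`: one step's amplification is absorbed into the exponential.
      have hE' : (1 + L * h) * E ≤ Real.exp (L * (n * h + h)) := by
        rw [mul_add, Real.exp_add, mul_comm, ← hE]
        gcongr
        rw [add_comm]
        exact Real.add_one_le_exp _
      have hE1 : 1 ≤ Real.exp (L * (n * h + h)) := Real.one_le_exp (by positivity)
      calc ‖Φ h ((Φ h)^[n] (x 0)) - x (n * h + h)‖
          ≤ ((1 + L * h) * ‖(Φ h)^[n] (x 0) - x (n * h)‖ + L * h ^ (p + 1)) + D * h ^ (p + 1) := by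
            refine (norm_sub_le_norm_sub_add_norm_sub _
              (∑ k ∈ Finset.range (p + 1), h ^ k • (ψ k).1 (x (n * h))) _).trans ?_
            rw [norm_sub_rev (∑ k ∈ Finset.range (p + 1), h ^ k • (ψ k).1 (x (n * h)))]
            exact add_le_add h1 h2
        _ ≤ ((1 + L * h) * (n * h * (L + D) * E * h ^ p) + L * h ^ (p + 1)) + D * h ^ (p + 1) := by
            gcongr
        _ = n * h * (L + D) * h ^ p * ((1 + L * h) * E) + h * (L + D) * h ^ p * 1 := by ring
        _ ≤ n * h * (L + D) * h ^ p * Real.exp (L * (n * h + h))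
            + h * (L + D) * h ^ p * Real.exp (L * (n * h + h)) := by gcongr
        _ = (n * h + h) * (L + D) * Real.exp (L * (n * h + h)) * h ^ p := by ring
  exact (main n hn).trans (hbound n hn)

end Convergence

theorem mainTheorem1 (N d : ℕ) (f : Fin N → SmoothMap d) (H : HierarchicalSplitting N d)
    (ord : Finset (Fin N) → ℕ) (err : Finset (Fin N) → SmoothMap d)
    (hord : ∀ v ∈ H.methodNodes, 1 ≤ ord v)
    (hexp : ∀ v ∈ H.methodNodes,
      HasExpExpansion (H.nodeMethod f v) (∑ m ∈ v, f m) (ord v) (err v))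
    (p : ℕ) (hp : IsLeast (ord '' (H.methodNodes : Set (Finset (Fin N)))) p) :
    HasExpExpansion (H.method f) (∑ m, f m) p
        (∑ v ∈ H.methodNodes with ord v = p, H.errorWeight p v • err v)
      ∧ ConvergesWithOrder (H.method f) (∑ m, f m) p := by
  have hp1 : 1 ≤ p := by
    obtain ⟨v, hv, rfl⟩ := hp.1
    exact hord v hv
  have key := H.hasExpExpansion_method f ord err hp1
    (fun v hv => hp.2 (Set.mem_image_of_mem ord hv)) hexp
  exact ⟨key, key.convergesWithOrder hp1⟩
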